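/- **Setting.** There are $n\ge 1$ students $A$, $m\ge 1$ schools $U$, and an integer $J\ge 1$. A student's record consists of a strict preference ordering $\succ_a$ of all $m$ schools (being unmatched, $\odot$, is worse than every school) and a score $\mathrm{score}_u(a)\in\{0,1,\dots,J\}$ at each school $u$; a database $D$ is a vector of $n$ records. Schools prefer higher scores, accept every student, and school $u$ has capacity $C_u\in\mathbb N$. Thresholds $t\in\{0,\dots,J\}^U$ induce the matching $\mu^t$ in which each student $a$ gets her favourite school among $\{u:\mathrm{score}_u(a)\ge t_u\}$ ($\odot$ if this set is empty). **Algorithm $\mathsf{PrivateDA}_{\varepsilon,\delta}$.** Let $$T=mnJ,\qquad \varepsilon'=\frac{\varepsilon}{16\sqrt{2m\ln(1/\delta)}},\qquad E=\frac{128\sqrt{m\ln(1/\delta)}}{\varepsilon}\,\ln\Big(\frac{2m}{\beta}\Big)\Big(\sqrt{\log_2(nT)}\Big)^5 .$$ Initially $t_u=J$ for all $u$, $\mu(a)=\odot$ for all $a$, and each school $u$ has its own counter $\mathrm{Counter}(\varepsilon',nT)$, with value $0$. While some school $u$ has counter value $<C_u-E$ and $t_u>0$, one such school is chosen (by any fixed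 rule that depends on the set of such schools and on the order in which schools have lowered their thresholds so far) and lowers $t_u$ by $1$; then, for the students one after the other, $\mu(a)$ is replaced by $\mu^t(a)$, and every counter receives one symbol: if $\mu(a)$ changes, the counter of the old school (if any) receives $-1$ and that of the new school receives $+1$; all others receive $0$. The output is the final $t$. Here $\mathrm{Counter}(\varepsilon',N)$ is the binary mechanism: at each time $s\le N$, with $2^i$ the largest power of $2$ dividing $s$, it stores the sum of the symbols at times $s-2^i+1,\dots,s$ plus fresh independent Laplace noise of scale $\log_2(N)/\varepsilon'$ (no noise if $N=1$); its value at time $t$ is the sum of the stored noisy sums over the dyadic blocks that the binary expansion of $t$ cuts $\{1,\dots,t\}$ into. **Definitions.** A matching $\mu$ is *feasible* if $|\mu^{-1}(u)|\le C_u$ for all $u$. It is *feasible and $\alpha$-approximately stable* if moreover (i) whenever $\mu(a)\ne u$, either $\mu(a)\succ_a u$ or every student in $\mu^{-1}(u)$ has a strictly higher score at $u$ than $a$; and (ii) if $|\mu^{-1}(u)|<(1-\alpha)C_u$, then every student $a$ has $\mu(a)=u$ or $\mu(a)\succ_a u$. For $\alpha=0$ it is *stable*. The *school-optimal* stable matching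 is the feasible stable matching $\mu'$ such that, for every feasible stable $\nu$, every school $u$ and every $s$, at least as many students with score $\ge s$ at $u$ are matched to $u$ in $\mu'$ as in $\nu$. A matching $\mu$ is *school-dominant* if for every $u$, every $a\in\mu^{-1}(u)\setminus\mu'^{-1}(u)$ has a strictly higher score at $u$ than every $a'\in\mu'^{-1}(u)\setminus\mu^{-1}(u)$. A randomized algorithm $M$ on databases is *$(\varepsilon,\delta)$-differentially private* if $\Pr[M(D)\in S]\le e^{\varepsilon}\Pr[M(D')\in S]+\delta$ for all $D,D'$ that differ in at most one record and all sets $S$ of outputs. A randomized matching mechanism $M$ is *$\eta$-approximately dominant-strategy truthful for students* if for every database $D$, every student $a$, every $v_a:U\cup\{\odot\}\to[0,1]$ with $v_a(x)\ge v_a(y)$ whenever $x\succ_a y$, and every database $D'$ that is obtained from $D$ by replacing $\succ_a$ by another ordering, $\mathbb E_{\mu\sim M(D)}[v_a(\mu(a))]\ge\mathbb E_{\mu\sim M(D')}[v_a(\mu(a))]-\eta$. **Theorem.** (1) Let $0<\varepsilon\le 1$, $0<\delta\le\frac12$, $0<\beta<1$, and let the capacities be arbitrary. Then $\mathsf{PrivateDA}_{\varepsilon,\delta}$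 is $(\varepsilon,\delta)$-differentially private, and the mechanism that runs it on the reported database and outputs the matching induced by the resulting thresholds is $(\varepsilon+\delta)$-approximately dominant-strategy truthful for students. (2) There are absolute constants $K>0$ and $p\in\mathbb N$ such that, for all $n,m,J\ge1$, all $\varepsilon,\delta,\beta$ as in (1), all $0<\alpha\le1$, all capacities with $$C_u\ \ge\ K\,\frac{\sqrt m}{\varepsilon\alpha}\,\Big(\ln\frac{nmJ}{\delta\beta}\Big)^{p}\qquad\text{for every school }u,$$ and every database in which different students have different scores at each school, with probability at least $1-\beta$ the thresholds that $\mathsf{PrivateDA}_{\varepsilon,\delta}$ outputs induce a feasible, $\alpha$-approximately stable and school-dominant matching. -/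

import Mathlib

open MeasureTheory

namespace PrivateDA

/-! ### Students, schools, matchings -/

/-- A strict preference ordering over the `m` schools, given by the rank of each school
(rank `0` is the favourite).  Bijections onto the ranks are the same as strict linear orders. -/
abbrev PrefOrder (m : ℕ) : Type := Fin m ≃ Fin m

/-- The private data of one student: her preference ordering over the schools, and her
score in `{0, …, J}` at every school. -/
structure Student (m J : ℕ) where
  pref : PrefOrder m
  score : Fin m → Fin (J + 1)

/-- A database lists the private data of `n` students. -/
abbrev Database (n m J : ℕ) : Type := Fin n → Student m J

/-- A matching; `none` stands for being unmatched. -/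
abbrev Matching (n m : ℕ) : Type := Fin n → Option (Fin m)

instance (m : ℕ) : MeasurableSpace (Option (Fin m)) := ⊤

/-- Admission thresholds, one for each school. -/
abbrev Thresholds (m : ℕ) : Type := Fin m → ℕ

/-- Strict preference between outcomes of a student: schools are compared by rank, and every
school is preferred to being unmatched. -/
def Prefers {m : ℕ} (p : PrefOrder m) : Option (Fin m) → Option (Fin m) → Prop
  | some u, some v => p u < p v
  | some _, none => True
  | none, _ => False

/-- The set of students matched to school `u`. -/
def enrolled {n m : ℕ} (μ : Matching n m) (u : Fin m) : Finset (Fin n) :=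
  Finset.univ.filter fun a => μ a = some u

/-- The favourite school among those whose threshold the student meets (`none` if there is no
such school). -/
def favourite {m J : ℕ} (s : Student m J) (t : Thresholds m) : Option (Fin m) :=
  ((List.finRange m).filter fun u => t u ≤ (s.score u : ℕ)).argmin s.pref

/-- The matching induced by admission thresholds. -/
def inducedMatching {n m J : ℕ} (D : Database n m J) (t : Thresholds m) : Matching n m :=
  fun a => favourite (D a) t

/-- At every school, different students have different scores. -/
def UniqueScores {n m J : ℕ} (D : Database n m J) : Prop :=
  ∀ u : Fin m, Function.Injective fun a : Fin n => (D a).score u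

/-! ### Stability and school dominance -/

def Feasible {n m : ℕ} (C : Fin m → ℕ) (μ : Matching n m) : Prop :=
  ∀ u, (enrolled μ u).card ≤ C u

/-- No blocking pairs with filled seats. -/
def NoFilledBlocking {n m J : ℕ} (D : Database n m J) (μ : Matching n m) : Prop :=
  ∀ (a : Fin n) (u : Fin m), μ a ≠ some u →
    Prefers (D a).pref (μ a) (some u) ∨
      ∀ a' : Fin n, μ a' = some u → (D a).score u < (D a').score u

/-- No blocking pairs with empty seats at schools that are under-enrolled by more than an
`α`-fraction of their capacity.  Every student is acceptable to every school. -/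
def NoEmptyBlocking {n m J : ℕ} (C : Fin m → ℕ) (α : ℝ) (D : Database n m J)
    (μ : Matching n m) : Prop :=
  ∀ u : Fin m, ((enrolled μ u).card : ℝ) < (1 - α) * (C u : ℝ) →
    ∀ a : Fin n, μ a = some u ∨ Prefers (D a).pref (μ a) (some u)

/-- `μ` is feasible and `α`-approximately stable; `α = 0` is exact stability. -/
def ApproxStable {n m J : ℕ} (C : Fin m → ℕ) (α : ℝ) (D : Database n m J)
    (μ : Matching n m) : Prop :=
  Feasible C μ ∧ NoFilledBlocking D μ ∧ NoEmptyBlocking C α D μ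

/-- `μ` is the school-optimal stable matching: it is feasible and stable, and every school finds
its set of students at least as good as in any other feasible stable matching `ν`, that is, for
every score `s` it gets at least as many students of score `s` or more under `μ` as under `ν`
(equivalently, the `k`-th best student under `μ` is at least as good as the `k`-th best student
under `ν`, for every `k`). -/
def SchoolOptimal {n m J : ℕ} (C : Fin m → ℕ) (D : Database n m J) (μ : Matching n m) : Prop :=
  ApproxStable C 0 D μ ∧
    ∀ ν : Matching n m, ApproxStable C 0 D ν → ∀ (u : Fin m) (s : ℕ),
      ((enrolled ν u).filter fun a => s ≤ ((D a).score u : ℕ)).card ≤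
        ((enrolled μ u).filter fun a => s ≤ ((D a).score u : ℕ)).card

/-- `μ` is school-dominant: each school strictly prefers every student that it has in `μ` but not
in the school-optimal stable matching `μ'` to every student that it has in `μ'` but not in `μ`. -/
def SchoolDominant {n m J : ℕ} (C : Fin m → ℕ) (D : Database n m J) (μ : Matching n m) : Prop :=
  ∃ μ' : Matching n m, SchoolOptimal C D μ' ∧
    ∀ (u : Fin m), ∀ a ∈ enrolled μ u \ enrolled μ' u, ∀ a' ∈ enrolled μ' u \ enrolled μ u,
      (D a').score u < (D a).score u

/-! ### Differential privacy and approximate truthfulness -/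

/-- Databases that differ in at most one student's record. -/
def Neighbours {n m J : ℕ} (D D' : Database n m J) : Prop :=
  ∃ i : Fin n, ∀ j : Fin n, j ≠ i → D j = D' j

/-- `(ε, δ)`-differential privacy of a randomized map `M`, given by its output distributions. -/
def DifferentiallyPrivate {n m J : ℕ} {R : Type*} [MeasurableSpace R] (ε δ : ℝ)
    (M : Database n m J → Measure R) : Prop :=
  ∀ D D' : Database n m J, Neighbours D D' → ∀ S : Set R, MeasurableSet S →
    M D S ≤ ENNReal.ofReal (Real.exp ε) * M D' S + ENNReal.ofReal δ

/-- A utility function with values in `[0, 1]` that is consistent with the preference ordering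
`p`: a preferred outcome never has smaller utility. -/
def ConsistentUtility {m : ℕ} (p : PrefOrder m) (v : Option (Fin m) → ℝ) : Prop :=
  (∀ x, 0 ≤ v x ∧ v x ≤ 1) ∧ ∀ x y, Prefers p x y → v y ≤ v x

/-- The database in which student `a` reports the preferences `p'`. -/
def misreport {n m J : ℕ} (D : Database n m J) (a : Fin n) (p' : PrefOrder m) :
    Database n m J :=
  Function.update D a { pref := p', score := (D a).score }

/-- `η`-approximate dominant strategy truthfulness for students of a randomized matching
mechanism. -/
def StudentTruthful {n m J : ℕ} (η : ℝ) (M : Database n m J → Measure (Matching n m)) : Prop :=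
  ∀ (D : Database n m J) (a : Fin n) (v : Option (Fin m) → ℝ),
    ConsistentUtility (D a).pref v → ∀ p' : PrefOrder m, p' ≠ (D a).pref →
      ∫ μ, v (μ a) ∂(M (misreport D a p')) - η ≤ ∫ μ, v (μ a) ∂(M D)

/-! ### The binary-mechanism counter -/

/-- The Laplace distribution with scale `b`, as the law of `b * X` where `X` has density
`exp (-|x|) / 2`.  For `b > 0` it has density `exp (-|x| / b) / (2 * b)`; for `b = 0` it is the
point mass at `0`. -/
noncomputable def laplace (b : ℝ) : Measure ℝ :=
  (volume.withDensity fun x : ℝ => ENNReal.ofReal (Real.exp (-|x|) / 2)).map fun x => b * x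

/-- The value that the binary mechanism shows after it has read the symbols `σ`, at time
`t = σ.length`.  Bit `j` of `t` contributes the sum over the block of the `2 ^ j` symbols that ends
at time `s = 2 ^ j * (t / 2 ^ j)`, with the noise `z s` that was added when the block
was completed (exactly one block is completed at each time). -/
noncomputable def binaryCounter (σ : List ℤ) (z : ℕ → ℝ) : ℝ :=
  ∑ j ∈ (Finset.range σ.length.size).filter (fun j => σ.length.testBit j),
    ((((σ.drop (2 ^ j * (σ.length / 2 ^ j) - 2 ^ j)).take (2 ^ j)).sum : ℤ) +
      z (2 ^ j * (σ.length / 2 ^ j)))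

/-! ### Private school-proposing deferred acceptance -/

/-- The horizon `n * T` of the counters, where `T = m * n * J`. -/
def horizon (n m J : ℕ) : ℕ := n * (m * n * J)

/-- The privacy parameter of each counter. -/
noncomputable def counterEps (m : ℕ) (ε δ : ℝ) : ℝ :=
  ε / (16 * √(2 * m * Real.log (1 / δ)))

/-- The number `E` of reserved seats. -/
noncomputable def reserve (n m J : ℕ) (ε δ β : ℝ) : ℝ :=
  128 * √(m * Real.log (1 / δ)) / ε * Real.log (2 * m / β) *
    √(Real.logb 2 (horizon n m J)) ^ 5

/-- A tape of noise values, one for each counter and each time up to the horizon `N` (counters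
release values at the times `1, …, N`; the entry at time `0` is never used). -/
abbrev NoiseTape (m N : ℕ) : Type := Fin m × Fin (N + 1) → ℝ

/-- Independent Laplace noise of scale `log₂ N / ε'` for all counters, where `N` is the horizon
and `ε'` the privacy parameter of the counters. -/
noncomputable def noise (n m J : ℕ) (ε δ : ℝ) : Measure (NoiseTape m (horizon n m J)) :=
  Measure.pi fun _ => laplace (Real.logb 2 (horizon n m J) / counterEps m ε δ)

/-- The state of the algorithm. -/
structure State (n m : ℕ) where
  /-- the current thresholds -/
  thr : Thresholds m
  /-- the current tentative matching -/
  mat : Matching n m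
  /-- the symbols sent so far to each counter -/
  stream : Fin m → List ℤ
  /-- the schools that have lowered their thresholds so far, latest first -/
  hist : List (Fin m)

/-- Thresholds start at `J`, all students are unmatched, and the counters have read nothing. -/
def initState (n m J : ℕ) : State n m where
  thr := fun _ => J
  mat := fun _ => none
  stream := fun _ => []
  hist := []

/-- The symbol that is sent to the counter of school `w` when a student moves from `old` to
`new`. -/
def symbol {m : ℕ} (old new : Option (Fin m)) (w : Fin m) : ℤ :=
  if old = new then 0 else if old = some w then -1 else if new = some w then 1 else 0

/-- One pass of the loop: school `u` lowers its threshold by one, and then, for one student after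
the other, the student moves to her favourite school and every counter gets one symbol. -/
def lower {n m J : ℕ} (D : Database n m J) (st : State n m) (u : Fin m) : State n m :=
  let thr' : Thresholds m := Function.update st.thr u (st.thr u - 1)
  let mat' : Matching n m := inducedMatching D thr'
  { thr := thr'
    mat := mat'
    stream := fun w => st.stream w ++ List.ofFn fun a : Fin n => symbol (st.mat a) (mat' a) w
    hist := u :: st.hist }

/-- The current value of the counter of school `u`. -/
noncomputable def counterValue {n m N : ℕ} (st : State n m) (ω : NoiseTape m N) (u : Fin m) : ℝ :=
  binaryCounter (st.stream u) fun t => ω (u, Fin.ofNat (N + 1) t)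

open scoped Classical in
/-- The schools that may lower their thresholds: the counter is below the reduced capacity `C u - E`
and the threshold is positive. -/
noncomputable def underEnrolled {n m N : ℕ} (C : Fin m → ℕ) (E : ℝ) (st : State n m)
    (ω : NoiseTape m N) : Finset (Fin m) :=
  Finset.univ.filter fun u => counterValue st ω u < (C u : ℝ) - E ∧ 0 < st.thr u

/-- A rule by which the algorithm chooses which school proceeds when there are several candidates;
it may depend on the publicly known order in which schools have lowered their thresholds. -/
abbrev Rule (m : ℕ) : Type := List (Fin m) → Finset (Fin m) → Fin m

/-- The rule always chooses one of the candidates. -/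
def Rule.Valid {m : ℕ} (pick : Rule m) : Prop :=
  ∀ (h : List (Fin m)) (s : Finset (Fin m)), s.Nonempty → pick h s ∈ s

open scoped Classical in
/-- One test of the loop condition, with one pass of the loop if the test succeeds. -/
noncomputable def step {n m J N : ℕ} (pick : Rule m) (C : Fin m → ℕ) (E : ℝ)
    (D : Database n m J) (ω : NoiseTape m N) (st : State n m) : State n m :=
  if (underEnrolled C E st ω).Nonempty then lower D st (pick st.hist (underEnrolled C E st ω))
  else st

/-- The state after at most `k` passes of the loop. -/
noncomputable def runFor {n m J N : ℕ} (pick : Rule m) (C : Fin m → ℕ) (E : ℝ)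
    (D : Database n m J) (ω : NoiseTape m N) : ℕ → State n m
  | 0 => initState n m J
  | k + 1 => step pick C E D ω (runFor pick C E D ω k)

/-- The thresholds when the loop has terminated.  Each pass lowers one threshold by one, so that
there are at most `m * J` passes. -/
noncomputable def finalThresholds {n m J N : ℕ} (pick : Rule m) (C : Fin m → ℕ) (E : ℝ)
    (D : Database n m J) (ω : NoiseTape m N) : Thresholds m :=
  (runFor pick C E D ω (m * J)).thr

/-- The output distribution of private school-proposing deferred acceptance with privacy
parameters `ε`, `δ` and failure probability `β`, on capacities `C` and database `D`. -/
noncomputable def privateDA {n m J : ℕ} (pick : Rule m) (C : Fin m → ℕ) (ε δ β : ℝ)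
    (D : Database n m J) : Measure (Thresholds m) :=
  (noise n m J ε δ).map (finalThresholds pick C (reserve n m J ε δ β) D)

/-! ### The definitions are what they should be -/

/-- The loop has indeed terminated after `m * J` passes. -/
theorem underEnrolled_final {n m J N : ℕ} (pick : Rule m) (hpick : pick.Valid) (C : Fin m → ℕ)
    (E : ℝ) (D : Database n m J) (ω : NoiseTape m N) :
    underEnrolled C E (runFor pick C E D ω (m * J)) ω = ∅ := by
  have key : ∀ k, underEnrolled C E (runFor pick C E D ω k) ω = ∅ ∨
      ∑ u, (runFor pick C E D ω k).thr u + k = m * J := by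
    intro k
    induction k with
    | zero => right; simp [runFor, initState]
    | succ k ih =>
      by_cases hne : (underEnrolled C E (runFor pick C E D ω k) ω).Nonempty
      · right
        have hsum := ih.resolve_left hne.ne_empty
        have hp := hpick (runFor pick C E D ω k).hist _ hne
        have hpos : 0 < (runFor pick C E D ω k).thr (pick (runFor pick C E D ω k).hist
          (underEnrolled C E (runFor pick C E D ω k) ω)) := by
          classical
          exact (Finset.mem_filter.mp hp).2.2
        simp only [runFor, step, if_pos hne, lower]
        rw [Finset.sum_update_of_mem (Finset.mem_univ _)]
        have := Finset.add_sum_erase Finset.univ (runFor pick C E D ω k).thr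
          (Finset.mem_univ (pick (runFor pick C E D ω k).hist
          (underEnrolled C E (runFor pick C E D ω k) ω)))
        rw [Finset.sdiff_singleton_eq_erase]
        omega
      · left
        simp only [runFor, step, if_neg hne]
        exact Finset.not_nonempty_iff_eq_empty.mp hne
  rcases key (m * J) with h | h
  · exact h
  · have h0 : ∑ u, (runFor pick C E D ω (m * J)).thr u = 0 := by omega
    rw [Finset.sum_eq_zero_iff] at h0
    rw [underEnrolled, Finset.filter_eq_empty_iff]
    intro u hu hh
    have := h0 u hu
    omega

instance (b : ℝ) : IsProbabilityMeasure (laplace b) := by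
  have h : IsProbabilityMeasure
      (volume.withDensity fun x : ℝ => ENNReal.ofReal (Real.exp (-|x|) / 2)) := by
    refine ⟨?_⟩
    rw [withDensity_apply _ MeasurableSet.univ, Measure.restrict_univ]
    have hint : ∫ x : ℝ, Real.exp (-|x|) = 2 := by
      rw [integral_comp_abs (f := fun x => Real.exp (-x)), integral_exp_neg_Ioi_zero, mul_one]
    have hi : Integrable fun x : ℝ => Real.exp (-|x|) := by
      by_contra hc
      rw [integral_undef hc] at hint
      norm_num at hint
    rw [← ofReal_integral_eq_lintegral_ofReal (hi.div_const 2)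
      (Filter.Eventually.of_forall fun x => by positivity), integral_div, hint]
    norm_num
  exact Measure.isProbabilityMeasure_map (by fun_prop)

theorem measurable_finalThresholds {n m J N : ℕ} (pick : Rule m) (C : Fin m → ℕ)
    (E : ℝ) (D : Database n m J) :
    Measurable (finalThresholds (N := N) pick C E D) := by
  have hcount : Countable (State n m) := by
    refine Function.Injective.countable
      (f := fun st : State n m => (st.thr, st.mat, st.stream, st.hist)) ?_
    rintro ⟨a, b, c, d⟩ ⟨a', b', c', d'⟩ h
    simp only [Prod.mk.injEq] at h
    obtain ⟨rfl, rfl, rfl, rfl⟩ := h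
    rfl
  let _ : MeasurableSpace (State n m) := ⊤
  have hue : ∀ (st : State n m),
      @Measurable _ (Finset (Fin m)) _ ⊤ fun ω : NoiseTape m N => underEnrolled C E st ω := by
    intro st
    let _ : MeasurableSpace (Finset (Fin m)) := ⊤
    refine measurable_to_countable' fun s => ?_
    have : (fun ω : NoiseTape m N => underEnrolled C E st ω) ⁻¹' {s} =
        ⋂ u, {ω | (counterValue st ω u < (C u : ℝ) - E ∧ 0 < st.thr u) ↔ u ∈ s} := by
      ext ω
      simp [underEnrolled, Finset.ext_iff]
    rw [this]
    refine MeasurableSet.iInter fun u => ?_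
    have hm : Measurable fun ω : NoiseTape m N => counterValue st ω u := by
      unfold counterValue binaryCounter
      fun_prop
    have h1 : MeasurableSet
        {ω : NoiseTape m N | counterValue st ω u < (C u : ℝ) - E ∧ 0 < st.thr u} :=
      (measurableSet_lt hm measurable_const).inter (MeasurableSet.const _)
    by_cases hu : u ∈ s
    · simpa only [hu, iff_true] using h1
    · simp only [hu, iff_false]
      exact h1.compl
  have hrun : ∀ k, Measurable fun ω : NoiseTape m N => runFor pick C E D ω k := by
    intro k
    induction k with
    | zero => exact measurable_const
    | succ k ih =>
      have hst : Measurable fun p : State n m × NoiseTape m N => step pick C E D p.2 p.1 := by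
        refine measurable_from_prod_countable_right fun st => ?_
        let _ : MeasurableSpace (Finset (Fin m)) := ⊤
        classical
        have hg : Measurable fun s : Finset (Fin m) =>
            if s.Nonempty then lower D st (pick st.hist s) else st := measurable_from_top
        have h2 := hg.comp (hue st)
        have h3 : (fun ω : NoiseTape m N => step pick C E D ω st) =
            (fun s : Finset (Fin m) =>
              if s.Nonempty then lower D st (pick st.hist s) else st) ∘
              fun ω : NoiseTape m N => underEnrolled C E st ω := by
          funext ω
          simp only [step, Function.comp_apply]
        exact h3 ▸ h2
      have h4 : (fun ω : NoiseTape m N => runFor pick C E D ω (k + 1)) =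
          (fun p : State n m × NoiseTape m N => step pick C E D p.2 p.1) ∘
            fun ω : NoiseTape m N => (runFor pick C E D ω k, ω) := by
        funext ω
        simp only [runFor, Function.comp_apply]
      have h5 : Measurable fun ω : NoiseTape m N => (runFor pick C E D ω k, ω) :=
        Measurable.prodMk ih measurable_id
      rw [h4]
      exact Measurable.comp hst h5
  have ht : Measurable (State.thr : State n m → Thresholds m) := measurable_from_top
  have h := ht.comp (hrun (m * J))
  exact h

instance {n m J : ℕ} (pick : Rule m) (C : Fin m → ℕ) (ε δ β : ℝ) (D : Database n m J) :
    IsProbabilityMeasure (privateDA pick C ε δ β D) := by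
  unfold privateDA noise
  exact Measure.isProbabilityMeasure_map (measurable_finalThresholds _ _ _ _).aemeasurable

theorem measurable_inducedMatching {n m J : ℕ} (D : Database n m J) :
    Measurable (inducedMatching D) :=
  measurable_of_countable _

end PrivateDA

open PrivateDA

/-! Privacy. Call the order in which the schools lower their thresholds the transcript. It
determines the thresholds without reference to the data (`thr_replay_eq`), and along a fixed
transcript each student only climbs her own preference list, so she joins and leaves every school at
most once. One changed record therefore alters the stream of each counter by at most 4 in ℓ¹
(`sum_abs_streamAt_sub_le`). Since a time lies in at most one dyadic block of each size, the block
sums of all counters together move by at most 16·m·(⌊log₂ N⌋ + 1) in squared ℓ²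
(`sum_sq_blockShift_le`). Adding these differences to the noise makes the run on the neighbouring
database produce the same transcript (`hist_runFor_shift`), and each added amount is determined by
strictly earlier noise (`blockShift_runFor_congr`). The privacy loss is thus controlled by an
exponential supermartingale; a Chernoff bound shows that it exceeds ε with probability at most δ
(`measure_loss_gt_le`, `measure_transcript_le`).

Truthfulness. For fixed thresholds the set of schools open to a student does not depend on the
preferences she reports, so a misreport can help only by changing the law of the thresholds, which
privacy bounds.

Accuracy. Suppose that all noise read by the tests is at most X ≤ E. Then a school lowers its
threshold only while it has a free seat, and with distinct scores it gains at most one student, so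
the matching stays feasible. Call thresholds saturated if every school with a positive threshold is
full. The thresholds never fall below saturated ones: a school sitting at its saturated threshold
would already hold all its students of the saturated matching and be full
(`Saturated.lt_of_card_lt`). The noiseless run with no reserve ends at saturated thresholds, which
are therefore the greatest; as every stable matching comes from saturated thresholds, they induce
the school-optimal one. The noisy run ends above them, which gives school dominance, and each school
with a positive final threshold has at most E + X ≤ αC empty seats. A union bound over all tests
supplies X; the reserve is large enough except when n = 1, where feasibility is trivial. -/

namespace PrivateDA

/-! ### Matchings induced by thresholds -/

theorem favourite_eq_some_iff {m J : ℕ} (s : Student m J) (t : Thresholds m) (u : Fin m) :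
    favourite s t = some u ↔
      t u ≤ (s.score u : ℕ) ∧ ∀ v, t v ≤ (s.score v : ℕ) → s.pref u ≤ s.pref v := by
  unfold favourite
  constructor
  · intro h
    have h1 := List.argmin_mem h
    refine ⟨by simpa using h1, fun v hv => ?_⟩
    exact List.le_of_mem_argmin (f := s.pref) (by simpa using hv) h
  · rintro ⟨h1, h2⟩
    refine (List.argmin_eq_some_iff).2 ⟨by simpa using h1, fun v hv => h2 v (by simpa using hv), ?_⟩
    intro v hv hle
    have : u = v := s.pref.injective (le_antisymm (h2 v (by simpa using hv)) hle)
    subst this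
    exact le_rfl

theorem favourite_eq_none_iff {m J : ℕ} (s : Student m J) (t : Thresholds m) :
    favourite s t = none ↔ ∀ v, (s.score v : ℕ) < t v := by
  unfold favourite
  rw [List.argmin_eq_none, List.filter_eq_nil_iff]
  simp

/-- A school that a student can attend is matched to her or is worse than her favourite. -/
theorem eq_or_prefers_favourite {m J : ℕ} (s : Student m J) (t : Thresholds m) (u : Fin m)
    (h : t u ≤ (s.score u : ℕ)) :
    favourite s t = some u ∨ Prefers s.pref (favourite s t) (some u) := by
  rcases hf : favourite s t with _ | v
  · exact absurd h (not_le.2 ((favourite_eq_none_iff s t).1 hf u))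
  · have h2 := ((favourite_eq_some_iff s t v).1 hf).2 u h
    rcases h2.eq_or_lt with h3 | h3
    · left; rw [s.pref.injective h3]
    · right; exact h3

/-- A student who still qualifies keeps her favourite school when thresholds increase. -/
theorem favourite_anti {m J : ℕ} (s : Student m J) {t t' : Thresholds m} (h : t' ≤ t) {u : Fin m}
    (hf : favourite s t' = some u) (hu : t u ≤ (s.score u : ℕ)) : favourite s t = some u :=
  (favourite_eq_some_iff s t u).2
    ⟨hu, fun v hv => ((favourite_eq_some_iff s t' u).1 hf).2 v ((h v).trans hv)⟩

theorem mem_enrolled {n m : ℕ} (μ : Matching n m) (u : Fin m) (a : Fin n) :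
    a ∈ enrolled μ u ↔ μ a = some u := by
  simp [enrolled]

theorem threshold_le_score {n m J : ℕ} {D : Database n m J} {t : Thresholds m} {u : Fin m}
    {a : Fin n} (h : inducedMatching D t a = some u) : t u ≤ ((D a).score u : ℕ) :=
  ((favourite_eq_some_iff _ _ _).1 h).1

theorem noFilledBlocking_inducedMatching {n m J : ℕ} (D : Database n m J) (t : Thresholds m) :
    NoFilledBlocking D (inducedMatching D t) := by
  intro a u hne
  by_cases h : t u ≤ ((D a).score u : ℕ)
  · exact Or.inl ((eq_or_prefers_favourite (D a) t u h).resolve_left hne)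
  · right
    intro a' ha'
    have := threshold_le_score ha'
    rw [Fin.lt_def]
    omega

/-- Thresholds at which every school that rejects some score is full. -/
def Saturated {n m J : ℕ} (C : Fin m → ℕ) (D : Database n m J) (s : Thresholds m) : Prop :=
  (∀ u, s u ≤ J) ∧ ∀ u, 0 < s u → C u ≤ (enrolled (inducedMatching D s) u).card

/-- A school that is not full at thresholds above saturated ones is strictly above its saturated
threshold. -/
theorem Saturated.lt_of_card_lt {n m J : ℕ} {C : Fin m → ℕ} {D : Database n m J}
    {s t : Thresholds m} (hs : Saturated C D s) (hst : s ≤ t) {u : Fin m}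
    (hlt : (enrolled (inducedMatching D t) u).card < C u) (ht : 0 < t u) : s u < t u := by
  refine lt_of_le_of_ne (hst u) fun heq => ?_
  have h1 := hs.2 u (heq ▸ ht)
  -- With equal thresholds at `u`, the students that `u` has under `s` still qualify under `t`, and
  -- their other options only shrink.
  have h2 : enrolled (inducedMatching D s) u ⊆ enrolled (inducedMatching D t) u := by
    intro a ha
    rw [mem_enrolled] at ha ⊢
    exact favourite_anti (D a) hst ha (heq ▸ threshold_le_score ha)
  exact absurd (h1.trans (Finset.card_le_card h2)) (not_le.2 hlt)

/-- Lowering the threshold of `u` by one adds at most one student to `u`. -/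
theorem card_enrolled_lower_self {n m J : ℕ} {D : Database n m J} (hD : UniqueScores D)
    (t : Thresholds m) (u : Fin m) :
    (enrolled (inducedMatching D (Function.update t u (t u - 1))) u).card ≤
      (enrolled (inducedMatching D t) u).card + 1 := by
  have hle : Function.update t u (t u - 1) ≤ t := by
    intro w
    by_cases h : w = u
    · subst h; simp
    · simp [h]
  have hsub : enrolled (inducedMatching D (Function.update t u (t u - 1))) u ⊆
      enrolled (inducedMatching D t) u ∪
        Finset.univ.filter fun a => ((D a).score u : ℕ) = t u - 1 := by
    intro a ha
    rw [mem_enrolled] at ha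
    have h1 := threshold_le_score ha
    rw [Function.update_self] at h1
    rw [Finset.mem_union, mem_enrolled, Finset.mem_filter]
    by_cases h : t u ≤ ((D a).score u : ℕ)
    · exact Or.inl (favourite_anti (D a) hle ha h)
    · exact Or.inr ⟨Finset.mem_univ _, by omega⟩
  refine (Finset.card_le_card hsub).trans ((Finset.card_union_le _ _).trans ?_)
  gcongr
  rw [Finset.card_le_one]
  intro a ha b hb
  rw [Finset.mem_filter] at ha hb
  exact hD u (Fin.ext (ha.2.trans hb.2.symm))

/-- Lowering the threshold of `u` does not add students to other schools. -/
theorem card_enrolled_lower_of_ne {n m J : ℕ} (D : Database n m J)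
    (t : Thresholds m) {u w : Fin m} (h : w ≠ u) :
    (enrolled (inducedMatching D (Function.update t u (t u - 1))) w).card ≤
      (enrolled (inducedMatching D t) w).card := by
  refine Finset.card_le_card fun a ha => ?_
  have hle : Function.update t u (t u - 1) ≤ t := by
    intro w
    by_cases h : w = u
    · subst h; simp
    · simp [h]
  rw [mem_enrolled] at ha ⊢
  have h1 := threshold_le_score ha
  rw [Function.update_of_ne h] at h1
  exact favourite_anti (D a) hle ha h1

/-- Every stable matching is induced by saturated thresholds. -/
theorem exists_saturated_of_stable {n m J : ℕ} {C : Fin m → ℕ} (hC : ∀ u, 0 < C u)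
    {D : Database n m J} {ν : Matching n m} (hν : ApproxStable C 0 D ν) :
    ∃ s, Saturated C D s ∧ inducedMatching D s = ν := by
  classical
  obtain ⟨hfeas, hfill, hempty⟩ := hν
  have hex : ∀ u, ∃ x : ℕ, x ≤ J ∧ (0 < x → C u ≤ (enrolled ν u).card) ∧
      (∀ a, ν a = some u → x ≤ ((D a).score u : ℕ)) ∧
      ∀ a, x ≤ ((D a).score u : ℕ) → ν a = some u ∨ Prefers (D a).pref (ν a) (some u) := by
    intro u
    -- A full school gets its lowest enrolled score as threshold (there is one because capacities
    -- are positive); a school with free seats gets 0, since stability then lets no student envy it.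
    by_cases hfull : C u ≤ (enrolled ν u).card
    · have hne : (enrolled ν u).Nonempty := by
        rw [← Finset.card_pos]
        exact (hC u).trans_le hfull
      obtain ⟨b, hb, hmin⟩ := Finset.exists_min_image (enrolled ν u)
        (fun a => ((D a).score u : ℕ)) hne
      refine ⟨((D b).score u : ℕ), Nat.lt_succ_iff.1 ((D b).score u).2, fun _ => hfull,
        fun a ha => hmin a ((mem_enrolled _ _ _).2 ha), fun a ha => ?_⟩
      by_cases hau : ν a = some u
      · exact Or.inl hau
      · refine Or.inr ((hfill a u hau).resolve_right fun hlt => ?_)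
        have := hlt b ((mem_enrolled _ _ _).1 hb)
        rw [Fin.lt_def] at this
        omega
    · refine ⟨0, Nat.zero_le _, fun h => absurd h (lt_irrefl _), fun _ _ => Nat.zero_le _,
        fun a _ => ?_⟩
      refine hempty u ?_ a
      rw [sub_zero, one_mul]
      exact_mod_cast not_le.1 hfull
  choose s hJ hpos hmem hpref using hex
  have hind : inducedMatching D s = ν := by
    funext a
    rcases hν : ν a with _ | w
    · refine (favourite_eq_none_iff _ _).2 fun v => ?_
      by_contra hv
      rcases hpref v a (not_lt.1 hv) with h | h
      · rw [hν] at h; cases h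
      · rw [hν] at h; exact h
    · refine (favourite_eq_some_iff _ _ _).2 ⟨hmem w a hν, fun v hv => ?_⟩
      rcases hpref v a hv with h | h
      · rw [hν] at h
        rw [Option.some.inj h]
      · rw [hν] at h
        exact le_of_lt h
  exact ⟨s, ⟨hJ, fun u hu => hind ▸ hpos u hu⟩, hind⟩

/-- The largest saturated thresholds induce the school-optimal stable matching. -/
theorem schoolOptimal_of_greatest {n m J : ℕ} {C : Fin m → ℕ} (hC : ∀ u, 0 < C u)
    {D : Database n m J} {t : Thresholds m} (hfeas : Feasible C (inducedMatching D t))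
    (hsat : Saturated C D t) (hmax : ∀ s, Saturated C D s → s ≤ t) :
    SchoolOptimal C D (inducedMatching D t) := by
  refine ⟨⟨hfeas, noFilledBlocking_inducedMatching D t, fun u hu a => ?_⟩, fun ν hν u x => ?_⟩
  · rw [sub_zero, one_mul] at hu
    have h0 : t u = 0 := by
      by_contra h
      have h1 := hsat.2 u (Nat.pos_of_ne_zero h)
      have h2 : (enrolled (inducedMatching D t) u).card < C u := by exact_mod_cast hu
      omega
    exact eq_or_prefers_favourite (D a) t u (by omega)
  · obtain ⟨s, hs, rfl⟩ := exists_saturated_of_stable hC hν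
    have hst := hmax s hs
    -- Students scoring at least `t u` stay at `u` when thresholds rise from `s` to `t`. For a
    -- smaller `x` the filter is void under `t`, and `t u > 0` makes `u` full there.
    by_cases hx : t u ≤ x
    · refine Finset.card_le_card fun a ha => ?_
      rw [Finset.mem_filter, mem_enrolled] at ha ⊢
      exact ⟨favourite_anti (D a) hst ha.1 (hx.trans ha.2), ha.2⟩
    · have h1 : ((enrolled (inducedMatching D t) u).filter
          fun a => x ≤ ((D a).score u : ℕ)) = enrolled (inducedMatching D t) u := by
        refine Finset.filter_true_of_mem fun a ha => ?_
        have := threshold_le_score ((mem_enrolled _ _ _).1 ha)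
        omega
      rw [h1]
      exact (Finset.card_filter_le _ _).trans ((hν.1 u).trans (hsat.2 u (by omega)))

/-- Thresholds above those of the school-optimal matching induce a school-dominant matching. -/
theorem schoolDominant_of_le {n m J : ℕ} {C : Fin m → ℕ} {D : Database n m J}
    {s t : Thresholds m} (hopt : SchoolOptimal C D (inducedMatching D s)) (hst : s ≤ t) :
    SchoolDominant C D (inducedMatching D t) := by
  refine ⟨_, hopt, fun u a ha a' ha' => ?_⟩
  rw [Finset.mem_sdiff, mem_enrolled, mem_enrolled] at ha ha'
  -- The threshold `t u` separates the two groups: it admits `a`, and it must have excluded `a'`,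
  -- who would otherwise have stayed at `u`.
  have h1 := threshold_le_score ha.1
  have h2 : ((D a').score u : ℕ) < t u := by
    by_contra h
    exact ha'.2 (favourite_anti (D a') hst ha'.1 (not_lt.1 h))
  rw [Fin.lt_def]
  omega

/-! ### Dyadic blocks and the binary counter -/

/-- The end of the block that bit `j` of `t` contributes to the value of a counter at time `t`. -/
def stamp (t j : ℕ) : ℕ := 2 ^ j * (t / 2 ^ j)

/-- The positions of the nonzero bits of `t`. -/
def bits (t : ℕ) : Finset ℕ := (Finset.range t.size).filter fun j => t.testBit j

/-- The sum of `f` over the dyadic block that is completed at time `s`. -/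
def blockSum (f : ℕ → ℤ) (s : ℕ) : ℤ := ∑ x ∈ Finset.Ico (s - 2 ^ padicValNat 2 s) s, f x

theorem mem_bits {t j : ℕ} : j ∈ bits t ↔ t.testBit j = true := by
  rw [bits, Finset.mem_filter, Finset.mem_range, and_iff_right_iff_imp]
  intro h
  by_contra hj
  have : t < 2 ^ j := (Nat.lt_size_self t).trans_le (Nat.pow_le_pow_right (by norm_num) (not_lt.1 hj))
  rw [Nat.testBit_eq_false_of_lt this] at h
  cases h

theorem div_mod_two_of_mem_bits {t j : ℕ} (h : j ∈ bits t) : t / 2 ^ j % 2 = 1 := by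
  rw [mem_bits, Nat.testBit_eq_decide_div_mod_eq] at h
  simpa using h

theorem div_pos_of_mem_bits {t j : ℕ} (h : j ∈ bits t) : 0 < t / 2 ^ j := by
  refine Nat.pos_of_ne_zero fun h0 => ?_
  have h1 := div_mod_two_of_mem_bits h
  simp [h0] at h1

/-- The quotient `t / 2 ^ j` is odd when bit `j` is set, so the end of a block determines its
length. This lets blocks, like noise entries, be indexed by their end times. -/
theorem padicValNat_stamp {t j : ℕ} (h : j ∈ bits t) : padicValNat 2 (stamp t j) = j := by
  have h1 := div_mod_two_of_mem_bits h
  have h2 := (div_pos_of_mem_bits h).ne'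
  have : Fact (Nat.Prime 2) := ⟨Nat.prime_two⟩
  rw [stamp, padicValNat.mul (by positivity) h2, padicValNat.prime_pow,
    padicValNat.eq_zero_of_not_dvd (by omega), add_zero]

theorem stamp_le (t j : ℕ) : stamp t j ≤ t := Nat.mul_div_le t (2 ^ j)

theorem stamp_injOn (t : ℕ) : Set.InjOn (stamp t) (bits t) := by
  intro i hi j hj hij
  rw [← padicValNat_stamp hi, ← padicValNat_stamp hj, hij]

theorem stamp_sub {t j : ℕ} (h : j ∈ bits t) : stamp t j - 2 ^ j = stamp t (j + 1) := by
  have h1 := div_mod_two_of_mem_bits h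
  have h2 : t / 2 ^ j = 2 * (t / 2 ^ (j + 1)) + 1 := by
    rw [pow_succ, ← Nat.div_div_eq_div_mul]
    omega
  rw [stamp, stamp, h2, Nat.mul_add, mul_one, Nat.add_sub_cancel, pow_succ, mul_assoc]

theorem stamp_succ_of_notMem {t j : ℕ} (h : j ∉ bits t) : stamp t (j + 1) = stamp t j := by
  rw [mem_bits, Nat.testBit_eq_decide_div_mod_eq] at h
  have h1 : ¬ t / 2 ^ j % 2 = 1 := by simpa using h
  have h2 : t / 2 ^ j = 2 * (t / 2 ^ (j + 1)) := by
    rw [pow_succ, ← Nat.div_div_eq_div_mul]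
    omega
  rw [stamp, stamp, h2, pow_succ, mul_assoc]

theorem card_bits_le (t : ℕ) : (bits t).card ≤ t.size :=
  (Finset.card_filter_le _ _).trans_eq (Finset.card_range _)

/-- `stamp t k` is `t` rounded down to a multiple of `2 ^ k`. The block of a set bit `k` is the
interval from `stamp t (k + 1)` to `stamp t k`, and an unset bit leaves the stamp in place, so the
sum telescopes. -/
theorem sum_blockSum (f : ℕ → ℤ) (t : ℕ) :
    ∑ j ∈ bits t, blockSum f (stamp t j) = ∑ x ∈ Finset.range t, f x := by
  have key : ∀ k, ∑ j ∈ Finset.range k, (if t.testBit j then blockSum f (stamp t j) else 0) =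
      ∑ x ∈ Finset.range t, f x - ∑ x ∈ Finset.range (stamp t k), f x := by
    intro k
    induction k with
    | zero => simp [stamp]
    | succ k ih =>
      rw [Finset.sum_range_succ, ih]
      by_cases hk : k ∈ bits t
      · have hsub := stamp_sub hk
        have hle : stamp t (k + 1) ≤ stamp t k := hsub ▸ Nat.sub_le _ _
        rw [if_pos (mem_bits.1 hk), blockSum, padicValNat_stamp hk, hsub,
          Finset.sum_Ico_eq_sub _ hle]
        ring
      · rw [if_neg (fun h => hk (mem_bits.2 h)), stamp_succ_of_notMem hk, add_zero]
  rw [bits, Finset.sum_filter, key, stamp, Nat.div_eq_of_lt (Nat.lt_size_self t)]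
  simp

theorem sum_take_drop (σ : List ℤ) (a k : ℕ) :
    ((σ.drop a).take k).sum = ∑ x ∈ Finset.Ico a (a + k), σ.getD x 0 := by
  induction k with
  | zero => simp
  | succ k ih =>
    rw [← add_assoc, Finset.sum_Ico_succ_top (by omega), ← ih, List.take_add_one, List.sum_append,
      List.getElem?_drop, List.getD_eq_getElem?_getD]
    rcases σ[a + k]? with _ | v <;> simp

theorem sum_range_getD (σ : List ℤ) : ∑ x ∈ Finset.range σ.length, σ.getD x 0 = σ.sum := by
  have := sum_take_drop σ 0 σ.length
  simpa using this.symm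

theorem binaryCounter_eq (σ : List ℤ) (z : ℕ → ℝ) :
    binaryCounter σ z = ∑ j ∈ bits σ.length,
      ((blockSum (fun x => σ.getD x 0) (stamp σ.length j) : ℤ) + z (stamp σ.length j)) := by
  unfold binaryCounter
  refine Finset.sum_congr rfl fun j hj => ?_
  have hj' : j ∈ bits σ.length := hj
  have h1 : 2 ^ j ≤ stamp σ.length j :=
    Nat.le_mul_of_pos_right _ (div_pos_of_mem_bits hj')
  rw [blockSum, padicValNat_stamp hj', ← stamp, sum_take_drop, Nat.sub_add_cancel h1]

/-- The total noise in the value of the counter of `u` at time `t`. -/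
def readNoise {m N : ℕ} (ω : NoiseTape m N) (u : Fin m) (t : ℕ) : ℝ :=
  ∑ j ∈ bits t, ω (u, Fin.ofNat (N + 1) (stamp t j))

/-! ### Runs of the algorithm -/

/-- The state after the schools in the list `h` (latest first) have lowered their thresholds. -/
def replay {n m J : ℕ} (D : Database n m J) : List (Fin m) → State n m
  | [] => initState n m J
  | u :: h => lower D (replay D h) u

section Replay

variable {n m J : ℕ} (D : Database n m J)

/-- The thresholds, which are the output, are a function of the transcript alone; it is enough to
make the transcript private. -/
theorem thr_replay_eq (D' : Database n m J) (h : List (Fin m)) :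
    (replay D h).thr = (replay D' h).thr := by
  induction h with
  | nil => rfl
  | cons u h ih => simp [replay, lower, ih]

theorem length_stream_replay (h : List (Fin m)) (u : Fin m) :
    ((replay D h).stream u).length = n * h.length := by
  induction h with
  | nil => simp [replay, initState]
  | cons w h ih => simp [replay, lower, ih, mul_add]

theorem thr_replay_le (h : List (Fin m)) (u : Fin m) : (replay D h).thr u ≤ J := by
  induction h with
  | nil => simp [replay, initState]
  | cons w h ih =>
    simp only [replay, lower, Function.update_apply]
    split_ifs with hw
    · subst hw; omega
    · exact ih

theorem mat_replay {h : List (Fin m)} (hne : h ≠ []) :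
    (replay D h).mat = inducedMatching D (replay D h).thr := by
  cases h with
  | nil => exact absurd rfl hne
  | cons u h => rfl

theorem symbol_eq (old new : Option (Fin m)) (w : Fin m) :
    symbol old new w = (if new = some w then 1 else 0) - (if old = some w then 1 else 0) := by
  unfold symbol
  by_cases h : old = new
  · simp [h]
  · by_cases h1 : old = some w
    · have h2 : new ≠ some w := fun h2 => h (h1.trans h2.symm)
      simp [h1, h2, Ne.symm h2]
    · simp [h, h1]

theorem sum_stream_replay (h : List (Fin m)) (w : Fin m) :
    ((replay D h).stream w).sum = ((enrolled (replay D h).mat w).card : ℤ) := by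
  have hcard : ∀ μ : Matching n m,
      ((enrolled μ w).card : ℤ) = ∑ a, if μ a = some w then 1 else 0 := by
    intro μ
    rw [enrolled, Finset.card_filter]
    push_cast
    rfl
  induction h with
  | nil => simp [replay, initState, enrolled]
  | cons u h ih =>
    simp only [replay, lower, List.sum_append, ih, List.sum_ofFn, symbol_eq,
      Finset.sum_sub_distrib, ← hcard]
    ring

/-- The symbols telescope to the current enrolment and the dyadic blocks tile the past, so a counter
is the true enrolment plus the noise of the blocks in use. -/
theorem counterValue_replay {N : ℕ} (h : List (Fin m)) (ω : NoiseTape m N) (u : Fin m) :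
    counterValue (replay D h) ω u =
      ((enrolled (replay D h).mat u).card : ℝ) + readNoise ω u (n * h.length) := by
  rw [counterValue, binaryCounter_eq, Finset.sum_add_distrib, ← Int.cast_sum, sum_blockSum,
    sum_range_getD, sum_stream_replay, length_stream_replay]
  rfl

/-- Noise enters a state only through the transcript; everything else is replayed from the data. -/
theorem runFor_eq_replay {N : ℕ} (pick : Rule m) (C : Fin m → ℕ) (E : ℝ) (ω : NoiseTape m N)
    (k : ℕ) : runFor pick C E D ω k = replay D (runFor pick C E D ω k).hist := by
  induction k with
  | zero => rfl
  | succ k ih =>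
    simp only [runFor, step]
    split_ifs with h
    · simp only [lower, replay, ← ih]
    · exact ih

theorem length_hist_le {N : ℕ} (pick : Rule m) (C : Fin m → ℕ) (E : ℝ) (ω : NoiseTape m N)
    (k : ℕ) : (runFor pick C E D ω k).hist.length ≤ k := by
  induction k with
  | zero => simp [runFor, initState]
  | succ k ih =>
    simp only [runFor, step]
    split_ifs with h
    · simpa [lower] using ih
    · omega

end Replay

/-! ### Accurate counters give approximately stable, school-dominant matchings -/

section Accuracy

variable {n m J N : ℕ} {pick : Rule m} {C : Fin m → ℕ} {E X : ℝ} {D : Database n m J}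
  {ω : NoiseTape m N}

/-- A school that may lower its threshold is not full. -/
theorem card_lt_of_counterValue_lt (hD : UniqueScores D) (hC : ∀ u, 2 ≤ C u)
    (hE : X ≤ E ∨ ∀ u, n < C u) {h : List (Fin m)} {u : Fin m}
    (hX : -X ≤ readNoise ω u (n * h.length))
    (hlt : counterValue (replay D h) ω u < (C u : ℝ) - E) :
    (enrolled (inducedMatching D (replay D h).thr) u).card < C u := by
  rcases hE with hE | hE
  -- Before the first pass the counters read 0 although the initial thresholds may already induce
  -- matches, so the counter says nothing here. Only a student of top score `J` can qualify at `u`,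
  -- hence at most one, and capacities are at least 2.
  · by_cases hne : h = []
    · refine lt_of_le_of_lt ?_ (hC u)
      rw [Finset.card_le_one]
      intro a ha b hb
      rw [mem_enrolled] at ha hb
      have h1 := threshold_le_score ha
      have h2 := threshold_le_score hb
      subst hne
      simp only [replay, initState] at h1 h2
      have h3 := ((D a).score u).2
      have h4 := ((D b).score u).2
      exact hD u (Fin.ext (by dsimp only; omega))
    · rw [counterValue_replay, mat_replay D hne] at hlt
      have : ((enrolled (inducedMatching D (replay D h).thr) u).card : ℝ) < C u := by linarith
      exact_mod_cast this
  · exact lt_of_le_of_lt ((Finset.card_le_univ _).trans (by simp)) (hE u)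

theorem card_mat_le (h : List (Fin m)) (u : Fin m) :
    (enrolled (replay D h).mat u).card ≤
      (enrolled (inducedMatching D (replay D h).thr) u).card := by
  by_cases hne : h = []
  · subst hne
    simp [replay, initState, enrolled]
  · rw [mat_replay D hne]

/-- Feasibility and lying above all saturated thresholds are invariants of the loop: each pass is
made by a school with a free seat. The final alternative is the failed loop test, with the counter
replaced by the enrolment at a cost of `X`. -/
theorem finalThresholds_spec (hpick : pick.Valid) (hD : UniqueScores D) (hC : ∀ u, 2 ≤ C u)
    (hE : X ≤ E ∨ ∀ u, n < C u) (hX : ∀ u, ∀ k ≤ m * J, |readNoise ω u (n * k)| ≤ X) :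
    Feasible C (inducedMatching D (finalThresholds pick C E D ω)) ∧
      (∀ s, Saturated C D s → s ≤ finalThresholds pick C E D ω) ∧
      ∀ u, finalThresholds pick C E D ω u ≤ J ∧ (finalThresholds pick C E D ω u = 0 ∨
        (C u : ℝ) - E - X ≤
          (enrolled (inducedMatching D (finalThresholds pick C E D ω)) u).card) := by
  classical
  have inv : ∀ k ≤ m * J, Feasible C (inducedMatching D (runFor pick C E D ω k).thr) ∧
      ∀ s, Saturated C D s → s ≤ (runFor pick C E D ω k).thr := by
    intro k
    induction k with
    | zero =>
      intro _
      refine ⟨fun u => ?_, fun s hs u => hs.1 u⟩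
      refine le_trans ?_ ((Nat.le_succ 1).trans (hC u))
      rw [Finset.card_le_one]
      intro a ha b hb
      rw [mem_enrolled] at ha hb
      have h1 := threshold_le_score ha
      have h2 := threshold_le_score hb
      simp only [runFor, initState] at h1 h2
      have h3 := ((D a).score u).2
      have h4 := ((D b).score u).2
      exact hD u (Fin.ext (by dsimp only; omega))
    | succ k ih =>
      intro hk
      obtain ⟨hf, hs⟩ := ih (by omega)
      simp only [runFor, step]
      split_ifs with hne
      · have hp := hpick (runFor pick C E D ω k).hist _ hne
        set u := pick (runFor pick C E D ω k).hist (underEnrolled C E (runFor pick C E D ω k) ω)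
        obtain ⟨hval, hpos⟩ := (Finset.mem_filter.mp hp).2
        have hlt : (enrolled (inducedMatching D (runFor pick C E D ω k).thr) u).card < C u := by
          rw [runFor_eq_replay] at hval ⊢
          exact card_lt_of_counterValue_lt hD hC hE
            (neg_le_of_abs_le (hX u _ ((length_hist_le D pick C E ω k).trans (by omega)))) hval
        refine ⟨fun w => ?_, fun s hsat w => ?_⟩
        · by_cases hw : w = u
          · rw [hw]
            exact (card_enrolled_lower_self hD _ u).trans hlt
          · exact (card_enrolled_lower_of_ne D _ hw).trans (hf w)
        · have h1 := hsat.lt_of_card_lt (hs s hsat) hlt hpos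
          have h2 := hs s hsat w
          simp only [lower, Function.update_apply]
          split_ifs with hw
          · rw [hw]; omega
          · exact h2
      · exact ⟨hf, hs⟩
  refine ⟨(inv _ le_rfl).1, (inv _ le_rfl).2, fun u => ⟨?_, ?_⟩⟩
  · rw [finalThresholds, runFor_eq_replay]
    exact thr_replay_le D _ u
  · have hfin := underEnrolled_final pick hpick C E D ω
    have hu : u ∉ underEnrolled C E (runFor pick C E D ω (m * J)) ω := by simp [hfin]
    rw [underEnrolled, Finset.mem_filter] at hu
    by_cases h0 : finalThresholds pick C E D ω u = 0
    · exact Or.inl h0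
    · right
      have h1 : ¬ counterValue (runFor pick C E D ω (m * J)) ω u < (C u : ℝ) - E :=
        fun h => hu ⟨Finset.mem_univ _, h, Nat.pos_of_ne_zero h0⟩
      rw [finalThresholds, runFor_eq_replay]
      rw [runFor_eq_replay, counterValue_replay] at h1
      have h2 := le_of_abs_le (hX u _ (length_hist_le D pick C E ω (m * J)))
      have h3 : ((enrolled (replay D (runFor pick C E D ω (m * J)).hist).mat u).card : ℝ) ≤ _ :=
        Nat.cast_le.2 (card_mat_le (D := D) (runFor pick C E D ω (m * J)).hist u)
      linarith

theorem approxStable_and_schoolDominant (hpick : pick.Valid) (hD : UniqueScores D)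
    (hC : ∀ u, 2 ≤ C u) (hE : X ≤ E ∨ ∀ u, n < C u) {α : ℝ}
    (hα : ∀ u, E + X ≤ α * C u) (hX : ∀ u, ∀ k ≤ m * J, |readNoise ω u (n * k)| ≤ X) :
    ApproxStable C α D (inducedMatching D (finalThresholds pick C E D ω)) ∧
      SchoolDominant C D (inducedMatching D (finalThresholds pick C E D ω)) := by
  obtain ⟨hfeas, hsat, hfin⟩ := finalThresholds_spec hpick hD hC hE hX
  refine ⟨⟨hfeas, noFilledBlocking_inducedMatching D _, fun u hu a => ?_⟩, ?_⟩
  · rcases (hfin u).2 with h | h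
    · exact eq_or_prefers_favourite (D a) _ u (by omega)
    · have := hα u
      linarith
  -- The same lemma, applied to the zero tape with no reserve, describes the exact algorithm: its
  -- thresholds are saturated and dominate all saturated ones.
  · obtain ⟨hfeas₀, hsat₀, hfin₀⟩ := finalThresholds_spec (pick := pick) (E := 0) (X := 0)
      (ω := (fun _ => 0 : NoiseTape m 0)) hpick hD hC (Or.inl le_rfl) (by simp [readNoise])
    have hs : Saturated C D
        (finalThresholds pick C 0 D (fun _ => 0 : NoiseTape m 0)) := by
      refine ⟨fun u => (hfin₀ u).1, fun u hu => ?_⟩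
      have h := (hfin₀ u).2.resolve_left hu.ne'
      rw [sub_zero, sub_zero] at h
      exact_mod_cast h
    exact schoolDominant_of_le
      (schoolOptimal_of_greatest (fun u => by have := hC u; omega) hfeas₀ hs hsat₀) (hsat _ hs)

end Accuracy

/-! ### The effect of one record on the block sums -/

section Blocks

theorem blockSum_congr {f g : ℕ → ℤ} {s : ℕ} (h : ∀ x < s, f x = g x) :
    blockSum f s = blockSum g s :=
  Finset.sum_congr rfl fun x hx => h x (Finset.mem_Ico.1 hx).2

theorem abs_blockSum_le (g : ℕ → ℤ) {s M : ℕ} (h : s ≤ M) :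
    |blockSum g s| ≤ ∑ x ∈ Finset.range M, |g x| := by
  refine (Finset.abs_sum_le_sum_abs _ _).trans
    (Finset.sum_le_sum_of_subset_of_nonneg (fun x hx => ?_) fun _ _ _ => abs_nonneg _)
  rw [Finset.mem_Ico] at hx
  rw [Finset.mem_range]
  omega

/-- A block is an aligned dyadic interval, so a point of it and its size determine where it ends. -/
theorem div_of_mem_block {s x : ℕ} (h : x ∈ Finset.Ico (s - 2 ^ padicValNat 2 s) s) :
    s = 2 ^ padicValNat 2 s * (x / 2 ^ padicValNat 2 s + 1) := by
  rw [Finset.mem_Ico] at h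
  obtain ⟨q, hq⟩ := (pow_padicValNat_dvd : 2 ^ padicValNat 2 s ∣ s)
  set v := 2 ^ padicValNat 2 s
  have hv : 0 < v := by positivity
  obtain ⟨r, rfl⟩ : ∃ r, q = r + 1 := by
    refine ⟨q - 1, ?_⟩
    rcases q with _ | q
    · rw [mul_zero] at hq; omega
    · rfl
  have h1 : v * r ≤ x := by
    have := h.1
    rw [hq, mul_add, mul_one, Nat.add_sub_cancel] at this
    exact this
  have h2 : x < v * r + v := by
    have := h.2
    rw [hq, mul_add, mul_one] at this
    exact this
  have h3 : x / v = r := by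
    refine Nat.div_eq_of_lt_le (by rwa [mul_comm]) ?_
    rw [mul_comm, mul_add, mul_one]
    exact h2
  rw [h3]
  exact hq

/-- Each time lies in at most one dyadic block of each size. -/
theorem card_blocks_le (N x : ℕ) :
    ((Finset.range (N + 1)).filter fun s =>
      x ∈ Finset.Ico (s - 2 ^ padicValNat 2 s) s).card ≤ Nat.log 2 N + 1 := by
  rw [← Finset.card_range (Nat.log 2 N + 1)]
  refine Finset.card_le_card_of_injOn (padicValNat 2) (fun s hs => ?_) fun s hs s' hs' heq => ?_
  · have hs := Finset.mem_filter.1 (Finset.mem_coe.1 hs)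
    have h1 := Finset.mem_range.1 hs.1
    have h2 := Finset.mem_Ico.1 hs.2
    rw [Finset.coe_range, Set.mem_Iio, Nat.lt_succ_iff]
    exact (padicValNat_le_nat_log s).trans (Nat.log_mono_right (by omega))
  · have hs := (Finset.mem_filter.1 (Finset.mem_coe.1 hs)).2
    have hs' := (Finset.mem_filter.1 (Finset.mem_coe.1 hs')).2
    rw [div_of_mem_block hs, div_of_mem_block hs', heq]

theorem sum_abs_blockSum_le (g : ℕ → ℤ) (N : ℕ) :
    ∑ s ∈ Finset.range (N + 1), |blockSum g s| ≤
      (Nat.log 2 N + 1) * ∑ x ∈ Finset.range N, |g x| := by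
  calc ∑ s ∈ Finset.range (N + 1), |blockSum g s|
      ≤ ∑ s ∈ Finset.range (N + 1), ∑ x ∈ Finset.range N,
          if x ∈ Finset.Ico (s - 2 ^ padicValNat 2 s) s then |g x| else 0 := by
        refine Finset.sum_le_sum fun s hs => (Finset.abs_sum_le_sum_abs _ _).trans ?_
        rw [← Finset.sum_filter]
        refine Finset.sum_le_sum_of_subset_of_nonneg (fun x hx => ?_) fun _ _ _ => abs_nonneg _
        rw [Finset.mem_filter]
        refine ⟨?_, hx⟩
        rw [Finset.mem_range] at hs ⊢
        have := (Finset.mem_Ico.1 hx).2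
        omega
    _ = ∑ x ∈ Finset.range N, (((Finset.range (N + 1)).filter fun s =>
          x ∈ Finset.Ico (s - 2 ^ padicValNat 2 s) s).card : ℤ) * |g x| := by
        rw [Finset.sum_comm]
        refine Finset.sum_congr rfl fun x _ => ?_
        rw [← Finset.sum_filter, Finset.sum_const, nsmul_eq_mul]
    _ ≤ ∑ x ∈ Finset.range N, ((Nat.log 2 N + 1 : ℕ) : ℤ) * |g x| := by
        refine Finset.sum_le_sum fun x _ => mul_le_mul_of_nonneg_right ?_ (abs_nonneg _)
        exact_mod_cast card_blocks_le N x
    _ = _ := by rw [Finset.mul_sum]; push_cast; rfl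

/-- The squared ℓ² norm is at most the sup norm times the ℓ¹ norm. No block sum exceeds `c`, and
each position is counted in at most `Nat.log 2 N + 1` blocks. -/
theorem sum_sq_blockSum_le {g : ℕ → ℤ} {N : ℕ} {c : ℤ}
    (h : ∑ x ∈ Finset.range N, |g x| ≤ c) :
    ∑ s ∈ Finset.range (N + 1), blockSum g s ^ 2 ≤ c ^ 2 * (Nat.log 2 N + 1) := by
  have hc : 0 ≤ c := (Finset.sum_nonneg fun _ _ => abs_nonneg _).trans h
  calc ∑ s ∈ Finset.range (N + 1), blockSum g s ^ 2
      ≤ ∑ s ∈ Finset.range (N + 1), c * |blockSum g s| := by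
        refine Finset.sum_le_sum fun s hs => ?_
        rw [← sq_abs, sq]
        refine mul_le_mul_of_nonneg_right ((abs_blockSum_le g ?_).trans h) (abs_nonneg _)
        rw [Finset.mem_range] at hs
        omega
    _ ≤ c * ((Nat.log 2 N + 1) * c) := by
        rw [← Finset.mul_sum]
        refine mul_le_mul_of_nonneg_left ((sum_abs_blockSum_le g N).trans ?_) hc
        exact mul_le_mul_of_nonneg_left h (by positivity)
    _ = _ := by ring

end Blocks

/-! ### The stream of one student -/

/-- The progress of a student with respect to school `u`: she has not reached `u` yet, is at `u`,
or is at a school that she prefers to `u`. -/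
def phase {m : ℕ} (p : PrefOrder m) (u : Fin m) : Option (Fin m) → ℤ
  | none => 0
  | some v => if v = u then 1 else if p v < p u then 2 else 0

theorem phase_le_two {m : ℕ} (p : PrefOrder m) (u : Fin m) (x : Option (Fin m)) :
    phase p u x ≤ 2 := by
  cases x with
  | none => simp [phase]
  | some v => simp only [phase]; split_ifs <;> norm_num

/-- The phase is a potential that never decreases as a student climbs her list, and each nonzero
symbol is paid for by an increase. As it ranges from 0 to 2, a student sends at most two nonzero
symbols to any counter. -/
theorem abs_symbol_le {m : ℕ} (p : PrefOrder m) (u : Fin m) {old new : Option (Fin m)}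
    (h : new = old ∨ Prefers p new old) :
    |symbol old new u| ≤ phase p u new - phase p u old := by
  rcases h with rfl | h
  · simp [symbol]
  · rw [symbol_eq]
    rcases new with _ | v
    · exact absurd h (by simp [Prefers])
    · rcases old with _ | w
      · simp only [phase, Option.some.injEq, reduceCtorEq, if_false]
        split_ifs <;> norm_num
      · have h' : p v < p w := h
        simp only [phase, Option.some.injEq]
        by_cases hv : v = u
        · subst hv
          have hw : w ≠ v := fun hw => by rw [hw] at h'; exact lt_irrefl _ h'
          simp [hw, not_lt.2 h'.le]
        · by_cases hw : w = u
          · subst hw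
            simp [hv, h']
          · by_cases hwu : p w < p u
            · simp [hv, hw, hwu, h'.trans hwu]
            · simp only [hv, hw, hwu, if_false]
              split_ifs <;> norm_num

section Streams

variable {n m J : ℕ} (D : Database n m J)

theorem thr_le_score_of_mat_replay {h : List (Fin m)} {a : Fin n} {v : Fin m}
    (hv : (replay D h).mat a = some v) : (replay D h).thr v ≤ ((D a).score v : ℕ) := by
  by_cases hne : h = []
  · subst hne
    simp [replay, initState] at hv
  · rw [mat_replay D hne] at hv
    exact threshold_le_score hv

/-- Students only ever move to schools that they prefer. -/
theorem mat_replay_cons (u : Fin m) (h : List (Fin m)) (a : Fin n) :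
    (replay D (u :: h)).mat a = (replay D h).mat a ∨
      Prefers (D a).pref ((replay D (u :: h)).mat a) ((replay D h).mat a) := by
  rcases hold : (replay D h).mat a with _ | v
  · rcases hnew : (replay D (u :: h)).mat a with _ | w
    · exact Or.inl rfl
    · exact Or.inr trivial
  · refine eq_or_prefers_favourite (D a) _ v ?_
    refine le_trans ?_ (thr_le_score_of_mat_replay D hold)
    by_cases hvu : v = u
    · subst hvu; simp
    · simp [hvu]

theorem mat_replay_congr {D' : Database n m J} {a : Fin n} (ha : D a = D' a) (h : List (Fin m)) :
    (replay D h).mat a = (replay D' h).mat a := by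
  cases h with
  | nil => rfl
  | cons u h => simp only [replay, lower, inducedMatching, ha, thr_replay_eq D D' h]

/-- The symbol that the counter of `u` receives at time `x + 1`, and `0` after the end. -/
def streamAt (h : List (Fin m)) (u : Fin m) (x : ℕ) : ℤ := ((replay D h).stream u).getD x 0

theorem streamAt_cons_of_lt (w : Fin m) (h : List (Fin m)) (u : Fin m) {x : ℕ}
    (hx : x < n * h.length) : streamAt D (w :: h) u x = streamAt D h u x := by
  simp only [streamAt, replay, lower]
  exact List.getD_append _ _ _ _ (by rwa [length_stream_replay])

theorem streamAt_cons_add (w : Fin m) (h : List (Fin m)) (u : Fin m) (a : Fin n) :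
    streamAt D (w :: h) u (n * h.length + a) =
      symbol ((replay D h).mat a) ((replay D (w :: h)).mat a) u := by
  simp only [streamAt, replay, lower]
  rw [List.getD_append_right _ _ _ _ (by rw [length_stream_replay]; omega), length_stream_replay,
    Nat.add_sub_cancel_left, List.getD_eq_getElem _ _ (by simp)]
  simp

theorem streamAt_eq_zero (h : List (Fin m)) (u : Fin m) {x : ℕ} (hx : n * h.length ≤ x) :
    streamAt D h u x = 0 :=
  List.getD_eq_default _ _ (by rwa [length_stream_replay])

theorem streamAt_of_suffix {h' h : List (Fin m)} (hs : h' <:+ h) (u : Fin m) {x : ℕ}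
    (hx : x < n * h'.length) : streamAt D h u x = streamAt D h' u x := by
  induction h with
  | nil => rw [List.suffix_nil.1 hs]
  | cons w h ih =>
    rcases List.suffix_cons_iff.1 hs with rfl | hs'
    · rfl
    · rw [streamAt_cons_of_lt D w h u (hx.trans_le (Nat.mul_le_mul_left _ hs'.length_le)), ih hs']

/-- Along a common transcript both databases see the same thresholds, so only student `i` can send
different symbols; the potentials of her two records pay for them. -/
theorem sum_abs_streamAt_sub_le_phase {D' : Database n m J} {i : Fin n}
    (hD : ∀ j, j ≠ i → D j = D' j) (h : List (Fin m)) (u : Fin m) :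
    ∑ x ∈ Finset.range (n * h.length), |streamAt D h u x - streamAt D' h u x| ≤
      phase (D i).pref u ((replay D h).mat i) + phase (D' i).pref u ((replay D' h).mat i) := by
  induction h with
  | nil => simp [replay, initState, phase]
  | cons w h ih =>
    rw [List.length_cons, mul_add, mul_one, Finset.sum_range_add]
    have h1 : ∑ a : Fin n, |streamAt D (w :: h) u (n * h.length + a) -
        streamAt D' (w :: h) u (n * h.length + a)| =
        |symbol ((replay D h).mat i) ((replay D (w :: h)).mat i) u -
          symbol ((replay D' h).mat i) ((replay D' (w :: h)).mat i) u| := by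
      rw [Finset.sum_eq_single i]
      · rw [streamAt_cons_add, streamAt_cons_add]
      · intro a _ ha
        rw [streamAt_cons_add, streamAt_cons_add, mat_replay_congr D (hD a ha),
          mat_replay_congr D (hD a ha), sub_self, abs_zero]
      · intro hi
        exact absurd (Finset.mem_univ i) hi
    have h2 : ∑ x ∈ Finset.range (n * h.length),
        |streamAt D (w :: h) u x - streamAt D' (w :: h) u x| =
        ∑ x ∈ Finset.range (n * h.length), |streamAt D h u x - streamAt D' h u x| := by
      refine Finset.sum_congr rfl fun x hx => ?_
      rw [streamAt_cons_of_lt D w h u (Finset.mem_range.1 hx),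
        streamAt_cons_of_lt D' w h u (Finset.mem_range.1 hx)]
    rw [h2, Finset.sum_range fun x => |streamAt D (w :: h) u (n * h.length + x) -
      streamAt D' (w :: h) u (n * h.length + x)|, h1]
    have h3 := abs_symbol_le (D i).pref u (mat_replay_cons D w h i)
    have h4 := abs_symbol_le (D' i).pref u (mat_replay_cons D' w h i)
    have h5 := abs_sub (symbol ((replay D h).mat i) ((replay D (w :: h)).mat i) u)
      (symbol ((replay D' h).mat i) ((replay D' (w :: h)).mat i) u)
    linarith

/-- A change of one record changes the stream of each counter by at most `4`. -/
theorem sum_abs_streamAt_sub_le {D' : Database n m J} (hD : Neighbours D D') (h : List (Fin m))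
    (u : Fin m) (M : ℕ) :
    ∑ x ∈ Finset.range M, |streamAt D h u x - streamAt D' h u x| ≤ 4 := by
  obtain ⟨i, hi⟩ := hD
  have h1 : ∑ x ∈ Finset.range M, |streamAt D h u x - streamAt D' h u x| ≤
      ∑ x ∈ Finset.range (n * h.length), |streamAt D h u x - streamAt D' h u x| := by
    rw [← Finset.sum_filter_add_sum_filter_not (Finset.range M) fun x => x < n * h.length]
    have h2 : ∑ x ∈ (Finset.range M).filter (fun x => ¬ x < n * h.length),
        |streamAt D h u x - streamAt D' h u x| = 0 := by
      refine Finset.sum_eq_zero fun x hx => ?_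
      have hx' := not_lt.1 (Finset.mem_filter.1 hx).2
      rw [streamAt_eq_zero D h u hx', streamAt_eq_zero D' h u hx', sub_self, abs_zero]
    rw [h2, add_zero]
    refine Finset.sum_le_sum_of_subset_of_nonneg (fun x hx => ?_) fun _ _ _ => abs_nonneg _
    exact Finset.mem_range.2 (Finset.mem_filter.1 hx).2
  have h2 := sum_abs_streamAt_sub_le_phase D hi h u
  have h3 := phase_le_two (D i).pref u ((replay D h).mat i)
  have h4 := phase_le_two (D' i).pref u ((replay D' h).mat i)
  linarith

/-- The difference of the sums over the dyadic block that is completed at time `s` at the counter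
of `u`, on two databases, when the schools in `h` have lowered their thresholds. -/
def blockShift (D D' : Database n m J) (h : List (Fin m)) (u : Fin m) (s : ℕ) : ℤ :=
  blockSum (streamAt D h u) s - blockSum (streamAt D' h u) s

theorem sum_sq_blockShift_le {D' : Database n m J} (hD : Neighbours D D') (h : List (Fin m))
    (N : ℕ) :
    ∑ i : Fin m × Fin (N + 1), blockShift D D' h i.1 i.2 ^ 2 ≤ m * (16 * (Nat.log 2 N + 1)) := by
  rw [Fintype.sum_prod_type]
  calc ∑ u : Fin m, ∑ s : Fin (N + 1), blockShift D D' h u s ^ 2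
      ≤ ∑ u : Fin m, 16 * ((Nat.log 2 N : ℤ) + 1) := by
        refine Finset.sum_le_sum fun u _ => ?_
        have h1 := sum_sq_blockSum_le (sum_abs_streamAt_sub_le D hD h u N)
        rw [Finset.sum_range] at h1
        refine le_trans (le_of_eq (Finset.sum_congr rfl fun s _ => ?_)) (h1.trans (by norm_num))
        rw [blockShift, blockSum, blockSum, blockSum, Finset.sum_sub_distrib]
    _ = _ := by simp

end Streams

/-! ### Transcripts -/

section Transcripts

variable {n m J N : ℕ} (pick : Rule m) (C : Fin m → ℕ) (E : ℝ) (D : Database n m J)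

theorem hist_suffix (ω : NoiseTape m N) {k K : ℕ} (hk : k ≤ K) :
    (runFor pick C E D ω k).hist <:+ (runFor pick C E D ω K).hist := by
  induction K, hk using Nat.le_induction with
  | base => exact List.suffix_rfl
  | succ K _ ih =>
    refine ih.trans ?_
    simp only [runFor, step]
    split_ifs
    · exact List.suffix_cons _ _
    · exact List.suffix_rfl

theorem counterValue_replay_eq_sum (h : List (Fin m)) (ω : NoiseTape m N) (u : Fin m) :
    counterValue (replay D h) ω u = ∑ j ∈ bits (n * h.length),
      ((blockSum (streamAt D h u) (stamp (n * h.length) j) : ℤ) +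
        ω (u, Fin.ofNat (N + 1) (stamp (n * h.length) j))) := by
  rw [counterValue, binaryCounter_eq, length_stream_replay]
  rfl

/-- Shifting the noise by the differences of the block sums turns a run on one database into a run
on another database with the same transcript. -/
theorem hist_runFor_shift (D' : Database n m J) (ω : NoiseTape m N) {K : ℕ} (hK : n * K ≤ N) :
    (runFor pick C E D' (fun i => ω i +
        (blockShift D D' (runFor pick C E D ω K).hist i.1 i.2 : ℝ)) K).hist =
      (runFor pick C E D ω K).hist := by
  set H := (runFor pick C E D ω K).hist with hH
  set ω' : NoiseTape m N := fun i => ω i + (blockShift D D' H i.1 i.2 : ℝ) with hω'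
  have key : ∀ k ≤ K, (runFor pick C E D' ω' k).hist = (runFor pick C E D ω k).hist := by
    intro k
    induction k with
    | zero => intro _; rfl
    | succ k ih =>
      intro hk
      have ihk := ih (by omega)
      have hsuf := hist_suffix pick C E D ω (show k ≤ K by omega)
      rw [← hH] at hsuf
      have e1 := runFor_eq_replay D pick C E ω k
      have e2 := runFor_eq_replay D' pick C E ω' k
      rw [ihk] at e2
      have hlen := length_hist_le D pick C E ω k
      set h := (runFor pick C E D ω k).hist with hh
      have hlen' : n * h.length ≤ N :=
        (Nat.mul_le_mul_left n (hlen.trans (by omega : k ≤ K))).trans hK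
      have hval : ∀ u, counterValue (replay D' h) ω' u = counterValue (replay D h) ω u := by
        intro u
        rw [counterValue_replay_eq_sum, counterValue_replay_eq_sum]
        refine Finset.sum_congr rfl fun j _ => ?_
        have hs := stamp_le (n * h.length) j
        set s := stamp (n * h.length) j
        have hval : ((Fin.ofNat (N + 1) s : Fin (N + 1)) : ℕ) = s := by
          simp [Nat.mod_eq_of_lt (show s < N + 1 by omega)]
        -- Blocks read at this test end within the current stream, so the final transcript `H` and
        -- its initial portion `h` give the same block sums.
        have hb : ∀ D'' : Database n m J,
            blockSum (streamAt D'' H u) s = blockSum (streamAt D'' h u) s := fun D'' =>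
          blockSum_congr fun x hx => streamAt_of_suffix D'' hsuf u (hx.trans_le hs)
        simp only [hω', blockShift, hval, hb]
        push_cast
        ring
      have hund : underEnrolled C E (runFor pick C E D' ω' k) ω' =
          underEnrolled C E (runFor pick C E D ω k) ω := by
        rw [e1, e2]
        simp only [underEnrolled, hval, thr_replay_eq D' D h]
      simp only [runFor, step, hund]
      split_ifs
      · simp only [lower, ihk]
        rw [← hh]
      · exact ihk
  exact key K le_rfl

/-- The first `k` passes depend only on the noise up to the time of the last test. -/
theorem runFor_congr {ω ω' : NoiseTape m N} {T : ℕ}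
    (h : ∀ u (s : Fin (N + 1)), (s : ℕ) ≤ T → ω (u, s) = ω' (u, s)) {k : ℕ}
    (hk : n * (k - 1) ≤ T) : runFor pick C E D ω k = runFor pick C E D ω' k := by
  induction k with
  | zero => rfl
  | succ k ih =>
    have ihk := ih ((Nat.mul_le_mul_left _ (by omega)).trans hk)
    rw [Nat.add_sub_cancel] at hk
    have hlen := length_hist_le D pick C E ω k
    have e1 := runFor_eq_replay D pick C E ω k
    have hund : underEnrolled C E (runFor pick C E D ω k) ω =
        underEnrolled C E (runFor pick C E D ω k) ω' := by
      have hval : ∀ u, counterValue (runFor pick C E D ω k) ω u =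
          counterValue (runFor pick C E D ω k) ω' u := by
        intro u
        rw [e1, counterValue_replay_eq_sum, counterValue_replay_eq_sum]
        refine Finset.sum_congr rfl fun j _ => ?_
        rw [h u]
        refine (Nat.mod_le _ _).trans ((stamp_le _ _).trans (le_trans ?_ hk))
        exact Nat.mul_le_mul_left _ hlen
      simp only [underEnrolled, hval]
    simp only [runFor, step]
    rw [← ihk, ← hund]

/-- As long as the loop has not terminated, every pass lowers a threshold. -/
theorem length_hist_of_nonempty (ω : NoiseTape m N) {k : ℕ}
    (h : (underEnrolled C E (runFor pick C E D ω k) ω).Nonempty) :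
    (runFor pick C E D ω k).hist.length = k := by
  induction k with
  | zero => rfl
  | succ k ih =>
    by_cases hne : (underEnrolled C E (runFor pick C E D ω k) ω).Nonempty
    · simp [runFor, step, if_pos hne, lower, ih hne]
    · simp only [runFor, step, if_neg hne] at h
      exact absurd h hne

/-- Later passes only append symbols. If the loop stopped before pass `k`, then the transcript no
longer changes at all; otherwise the first `n * k` symbols are already written. -/
theorem streamAt_runFor (D' : Database n m J) (ω : NoiseTape m N) {k K : ℕ} (hk : k ≤ K)
    (u : Fin m) {x : ℕ} (hx : x < n * k) :
    streamAt D' (runFor pick C E D ω K).hist u x =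
      streamAt D' (runFor pick C E D ω k).hist u x := by
  induction K, hk using Nat.le_induction with
  | base => rfl
  | succ K hK ih =>
    rw [← ih]
    simp only [runFor, step]
    split_ifs with hne
    · simp only [lower]
      refine streamAt_cons_of_lt D' _ _ u ?_
      rw [length_hist_of_nonempty pick C E D ω hne]
      exact hx.trans_le (Nat.mul_le_mul_left _ hK)
    · rfl

/-- The difference of the block sums at time `s` depends only on the noise at earlier times. -/
theorem blockShift_runFor_congr (hn : 0 < n) (D' : Database n m J) {ω ω' : NoiseTape m N} {s : ℕ}
    (h : ∀ u (s' : Fin (N + 1)), (s' : ℕ) < s → ω (u, s') = ω' (u, s')) (K : ℕ) (u : Fin m) :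
    blockShift D D' (runFor pick C E D ω K).hist u s =
      blockShift D D' (runFor pick C E D ω' K).hist u s := by
  have key : ∀ D'' : Database n m J, ∀ x < s,
      streamAt D'' (runFor pick C E D ω K).hist u x =
        streamAt D'' (runFor pick C E D ω' K).hist u x := by
    intro D'' x hx
    have hT : ∀ u (s' : Fin (N + 1)), (s' : ℕ) ≤ x → ω (u, s') = ω' (u, s') :=
      fun u s' hs' => h u s' (by omega)
    have hdiv := Nat.mul_div_le x n
    -- The symbol with index `x` is written in pass `x / n + 1`. The test before that pass reads
    -- noise up to time `n * (x / n) ≤ x`, hence before `s`.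
    by_cases hk : x / n + 1 ≤ K
    · have hlt : x < n * (x / n + 1) := Nat.lt_mul_div_succ x hn
      rw [streamAt_runFor pick C E D D'' ω hk u hlt, streamAt_runFor pick C E D D'' ω' hk u hlt,
        runFor_congr pick C E D hT (by simpa using hdiv)]
    · rw [runFor_congr pick C E D hT ((Nat.mul_le_mul_left n (by omega)).trans hdiv)]
  rw [blockShift, blockShift, blockSum_congr (key D), blockSum_congr (key D')]

end Transcripts

/-! ### The standard Laplace distribution -/

/-- The Laplace distribution of scale `1`. -/
noncomputable def stdLaplace : Measure ℝ :=
  volume.withDensity fun x : ℝ => ENNReal.ofReal (Real.exp (-|x|) / 2)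

theorem laplace_eq_map (b : ℝ) : laplace b = stdLaplace.map fun x => b * x := rfl

instance : IsProbabilityMeasure stdLaplace := by
  have h : laplace 1 = stdLaplace := by
    rw [laplace_eq_map]
    simp
  rw [← h]
  infer_instance

theorem lintegral_stdLaplace {f : ℝ → ENNReal} (hf : Measurable f) :
    ∫⁻ x, f x ∂stdLaplace = ∫⁻ x, ENNReal.ofReal (Real.exp (-|x|) / 2) * f x := by
  rw [stdLaplace, lintegral_withDensity_eq_lintegral_mul _ (by fun_prop) hf]
  rfl

/-- Change of variables for a translation of the Laplace distribution. -/
theorem lintegral_stdLaplace_add {f : ℝ → ENNReal} (hf : Measurable f) (d : ℝ) :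
    ∫⁻ x, f (x + d) * ENNReal.ofReal (Real.exp (|x| - |x + d|)) ∂stdLaplace =
      ∫⁻ x, f x ∂stdLaplace := by
  rw [lintegral_stdLaplace (by fun_prop), lintegral_stdLaplace hf,
    ← lintegral_add_right_eq_self (fun x => ENNReal.ofReal (Real.exp (-|x|) / 2) * f x) d]
  refine lintegral_congr fun x => ?_
  rw [mul_comm (f _), ← mul_assoc, ← ENNReal.ofReal_mul (by positivity), div_mul_eq_mul_div,
    ← Real.exp_add]
  congr 4
  ring

theorem lintegral_exp_half_abs_stdLaplace :
    ∫⁻ x, ENNReal.ofReal (Real.exp (|x| / 2)) ∂stdLaplace = 2 := by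
  rw [lintegral_stdLaplace (by fun_prop)]
  have h1 : ∀ x : ℝ, ENNReal.ofReal (Real.exp (-|x|) / 2) * ENNReal.ofReal (Real.exp (|x| / 2)) =
      ENNReal.ofReal (Real.exp (-|x| / 2) / 2) := by
    intro x
    rw [← ENNReal.ofReal_mul (by positivity), div_mul_eq_mul_div, ← Real.exp_add]
    congr 3
    ring
  simp_rw [h1]
  have hint : ∫ x : ℝ, Real.exp (-|x| / 2) = 4 := by
    rw [integral_comp_abs (f := fun x => Real.exp (-x / 2))]
    have := integral_exp_mul_Ioi (a := -(1 / 2 : ℝ)) (by norm_num) 0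
    rw [show (fun x : ℝ => Real.exp (-x / 2)) = fun x => Real.exp (-(1 / 2) * x) by
      funext x; congr 1; ring, this]
    norm_num
  have hi : Integrable fun x : ℝ => Real.exp (-|x| / 2) := by
    by_contra hc
    rw [integral_undef hc] at hint
    norm_num at hint
  rw [← ofReal_integral_eq_lintegral_ofReal (hi.div_const 2)
    (Filter.Eventually.of_forall fun x => by positivity), integral_div, hint]
  norm_num

/-- The moment generating function of the privacy loss of the Laplace mechanism. -/
theorem lintegral_exp_loss_le (d : ℝ) {l : ℝ} (hl : 0 ≤ l) :
    ∫⁻ x, ENNReal.ofReal (Real.exp (l * (|x + d| - |x|))) ∂stdLaplace ≤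
      ENNReal.ofReal (Real.exp (l * (l + 1) * d ^ 2 / 2)) := by
  set X : ℝ → ℝ := fun x => |x + d| - |x| with hX
  have hmeas : Measurable X := by fun_prop
  have hmem : ∀ x, X x ∈ Set.Icc (-|d|) |d| := by
    intro x
    have h1 := abs_add_le x d
    have h2 := abs_sub_abs_le_abs_sub x (x + d)
    rw [show x - (x + d) = -d by ring, abs_neg] at h2
    simp only [hX, Set.mem_Icc]
    constructor <;> linarith
  -- Hoeffding's lemma: the loss lies in an interval of length `2|d|`, so after centring it is
  -- sub-Gaussian with parameter `d²`.
  have hsg := ProbabilityTheory.hasSubgaussianMGF_of_mem_Icc (μ := stdLaplace) hmeas.aemeasurable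
    (Filter.Eventually.of_forall hmem)
  set c := ∫ x, X x ∂stdLaplace with hc
  have hpar : (((‖|d| - -|d|‖₊ / 2) ^ 2 : NNReal) : ℝ) = d ^ 2 := by
    push_cast
    rw [Real.norm_eq_abs, sub_neg_eq_add, ← two_mul, abs_mul, abs_abs, abs_two,
      mul_div_cancel_left₀ _ two_ne_zero, sq_abs]
  have hmgf : ∀ t : ℝ, ∫⁻ x, ENNReal.ofReal (Real.exp (t * X x)) ∂stdLaplace ≤
      ENNReal.ofReal (Real.exp (t * c + d ^ 2 * t ^ 2 / 2)) := by
    intro t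
    have h1 := hsg.mgf_le t
    have h2 := hsg.integrable_exp_mul t
    rw [hpar, ProbabilityTheory.mgf] at h1
    calc ∫⁻ x, ENNReal.ofReal (Real.exp (t * X x)) ∂stdLaplace
        = ∫⁻ x, ENNReal.ofReal (Real.exp (t * c)) *
            ENNReal.ofReal (Real.exp (t * (X x - c))) ∂stdLaplace := by
          refine lintegral_congr fun x => ?_
          rw [← ENNReal.ofReal_mul (by positivity), ← Real.exp_add]
          congr 2
          ring
      _ = ENNReal.ofReal (Real.exp (t * c)) *
            ENNReal.ofReal (∫ x, Real.exp (t * (X x - c)) ∂stdLaplace) := by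
          rw [lintegral_const_mul _ (by fun_prop), ofReal_integral_eq_lintegral_ofReal h2
            (Filter.Eventually.of_forall fun x => by positivity)]
      _ ≤ _ := by
          rw [← ENNReal.ofReal_mul (by positivity), Real.exp_add]
          refine ENNReal.ofReal_le_ofReal ?_
          exact mul_le_mul_of_nonneg_left h1 (by positivity)
  -- The likelihood ratio of the translated law integrates to 1. Inserted in the sub-Gaussian bound
  -- at `-1`, this makes the mean loss at most `d² / 2`, quadratic in `d` rather than linear.
  have hone : ∫⁻ x, ENNReal.ofReal (Real.exp (-1 * X x)) ∂stdLaplace = 1 := by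
    have h := lintegral_stdLaplace_add (f := fun _ => 1) measurable_const d
    simp only [one_mul, lintegral_const, measure_univ, mul_one] at h
    rw [← h]
    refine lintegral_congr fun x => ?_
    congr 2
    simp only [hX]
    ring
  have hcd : c ≤ d ^ 2 / 2 := by
    have h := hmgf (-1)
    rw [hone, ENNReal.one_le_ofReal, Real.one_le_exp_iff] at h
    linarith
  refine (hmgf l).trans (ENNReal.ofReal_le_ofReal (Real.exp_le_exp.2 ?_))
  have := mul_le_mul_of_nonneg_left hcd hl
  linarith

/-! ### Product measures -/

section Pi

variable {ι : Type*} [Fintype ι]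

theorem lintegral_pi_prod (ν : Measure ℝ) [IsProbabilityMeasure ν] (s : Finset ι)
    {f : ι → ℝ → ENNReal} (hf : ∀ i, Measurable (f i)) :
    ∫⁻ ω, ∏ i ∈ s, f i (ω i) ∂(Measure.pi fun _ : ι => ν) = ∏ i ∈ s, ∫⁻ x, f i x ∂ν := by
  have hind : ProbabilityTheory.iIndepFun (fun i (ω : ι → ℝ) => f i (ω i))
      (Measure.pi fun _ : ι => ν) :=
    ProbabilityTheory.iIndepFun_pi (X := f) fun i => (hf i).aemeasurable
  rw [ProbabilityTheory.lintegral_prod_eq_prod_lintegral_of_indepFun s _ hind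
    fun i => (hf i).comp (measurable_pi_apply i)]
  refine Finset.prod_congr rfl fun i _ => ?_
  have := (measurePreserving_eval (fun _ : ι => ν) i).lintegral_comp (hf i)
  exact this

theorem lintegral_pi_update [DecidableEq ι] (ν : Measure ℝ) [IsProbabilityMeasure ν]
    {f : (ι → ℝ) → ENNReal} (hf : Measurable f) (a : ι) :
    ∫⁻ ω, f ω ∂(Measure.pi fun _ : ι => ν) =
      ∫⁻ ω, ∫⁻ x, f (Function.update ω a x) ∂ν ∂(Measure.pi fun _ : ι => ν) := by
  have hm : Measurable fun ω : ι → ℝ => ∫⁻ x, f (Function.update ω a x) ∂ν := by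
    refine Measurable.lintegral_prod_right' (f := fun p : (ι → ℝ) × ℝ => f (Function.update p.1 a p.2))
      (hf.comp ?_)
    rw [measurable_pi_iff]
    intro i
    by_cases h : i = a
    · subst h
      simpa using measurable_snd
    · simp only [Function.update_of_ne h]
      fun_prop
  rw [lintegral_eq_lmarginal_univ (μ := fun _ : ι => ν) (fun _ => (0 : ℝ)),
    lintegral_eq_lmarginal_univ (μ := fun _ : ι => ν) (fun _ => (0 : ℝ)),
    lmarginal_erase' _ hf (Finset.mem_univ a), lmarginal_erase' _ hm (Finset.mem_univ a)]
  simp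

/-- A product of functions with conditional means at most `1` has mean at most `1`. -/
theorem lintegral_prod_adapted_le_one (ν : Measure ℝ) [IsProbabilityMeasure ν] {r : ι → ℕ}
    (hr : Function.Injective r) [DecidableEq ι] {ψ : ι → (ι → ℝ) → ENNReal}
    (hψ : ∀ i, Measurable (ψ i))
    (hdep : ∀ i ω ω', (∀ j, r j ≤ r i → ω j = ω' j) → ψ i ω = ψ i ω')
    (hint : ∀ i ω, ∫⁻ x, ψ i (Function.update ω i x) ∂ν ≤ 1) (s : Finset ι) :
    ∫⁻ ω, ∏ i ∈ s, ψ i ω ∂(Measure.pi fun _ : ι => ν) ≤ 1 := by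
  induction s using Finset.induction_on_max_value r with
  | empty => simp
  -- The coordinate `a` has the largest rank, so no factor of `s` depends on it; it is integrated
  -- out first and contributes at most 1.
  | insert a s ha hmax ih =>
    refine le_trans (le_of_eq (lintegral_pi_update ν ?_ a)) ?_
    · exact Finset.measurable_fun_prod _ fun i _ => hψ i
    · refine le_trans (lintegral_mono fun ω => ?_) ih
      have h1 : ∀ x, ∏ i ∈ insert a s, ψ i (Function.update ω a x) =
          ψ a (Function.update ω a x) * ∏ i ∈ s, ψ i ω := by
        intro x
        rw [Finset.prod_insert ha]
        congr 1
        refine Finset.prod_congr rfl fun i hi => hdep i _ _ fun j hj => ?_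
        have hja : j ≠ a := by
          rintro rfl
          have := hr (le_antisymm hj (hmax i hi))
          subst this
          exact ha hi
        exact Function.update_of_ne hja _ _
      simp_rw [h1]
      rw [lintegral_mul_const]
      · exact mul_le_of_le_one_left zero_le (hint a ω)
      · exact (hψ a).comp (measurable_update ω)

/-- Change of variables for a translation of independent Laplace noise. -/
theorem lintegral_pi_stdLaplace_add {f : (ι → ℝ) → ENNReal} (hf : Measurable f) (v : ι → ℝ) :
    ∫⁻ ω, f (ω + v) * ∏ i, ENNReal.ofReal (Real.exp (|ω i| - |ω i + v i|))
        ∂(Measure.pi fun _ : ι => stdLaplace) =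
      ∫⁻ ω, f ω ∂(Measure.pi fun _ : ι => stdLaplace) := by
  set ρ : (ι → ℝ) → ENNReal :=
    fun ω => ∏ i, ENNReal.ofReal (Real.exp (|ω i| - |ω i + v i|)) with hρ
  have hρm : Measurable ρ := by
    refine Finset.measurable_fun_prod _ fun i _ => ?_
    fun_prop
  have hmap : (Measure.pi fun _ : ι => stdLaplace) =
      ((Measure.pi fun _ : ι => stdLaplace).withDensity ρ).map (fun ω => ω + v) := by
    refine Measure.pi_eq fun S hS => ?_
    rw [Measure.map_apply (by fun_prop) (MeasurableSet.univ_pi hS),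
      withDensity_apply _ (measurableSet_preimage (by fun_prop) (MeasurableSet.univ_pi hS)),
      ← lintegral_indicator (measurableSet_preimage (by fun_prop) (MeasurableSet.univ_pi hS))]
    have h1 : ∀ ω : ι → ℝ, ((fun ω => ω + v) ⁻¹' Set.univ.pi S).indicator ρ ω =
        ∏ i, (S i).indicator 1 (ω i + v i) *
          ENNReal.ofReal (Real.exp (|ω i| - |ω i + v i|)) := by
      intro ω
      rw [Finset.prod_mul_distrib]
      by_cases h : ω + v ∈ Set.univ.pi S
      · rw [Set.indicator_of_mem (by exact h), Finset.prod_eq_one, one_mul]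
        intro i _
        exact Set.indicator_of_mem (h i (Set.mem_univ i)) _
      · rw [Set.indicator_of_notMem (by exact h)]
        obtain ⟨i, hi⟩ : ∃ i, ω i + v i ∉ S i := by
          by_contra hc
          push Not at hc
          exact h fun i _ => hc i
        rw [Finset.prod_eq_zero (Finset.mem_univ i) (Set.indicator_of_notMem hi _), zero_mul]
    simp_rw [h1]
    have hind : ∀ i, Measurable ((S i).indicator (1 : ℝ → ENNReal)) :=
      fun i => measurable_one.indicator (hS i)
    rw [lintegral_pi_prod stdLaplace Finset.univ (f := fun i x => (S i).indicator 1 (x + v i) *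
      ENNReal.ofReal (Real.exp (|x| - |x + v i|)))]
    · refine Finset.prod_congr rfl fun i _ => ?_
      rw [lintegral_stdLaplace_add (hind i), lintegral_indicator_one (hS i)]
    · intro i
      exact ((hind i).comp (measurable_add_const (v i))).mul (by fun_prop)
  conv_rhs => rw [hmap]
  rw [lintegral_map hf (by fun_prop),
    lintegral_withDensity_eq_lintegral_mul _ hρm (by exact hf.comp (measurable_add_const v))]
  refine lintegral_congr fun ω => ?_
  rw [Pi.mul_apply, mul_comm]

/-- If the noise is translated by `v`, then events on which the privacy loss is at most `ε` gain at
most a factor `exp ε`. -/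
theorem measure_le_of_loss_le {ε : ℝ} {A B : Set (ι → ℝ)} (hA : MeasurableSet A)
    (hB : MeasurableSet B) (v : ι → ℝ) (hAB : ∀ ω ∈ A, ω + v ∈ B)
    (hloss : ∀ ω ∈ A, ∑ i, (|ω i + v i| - |ω i|) ≤ ε) :
    (Measure.pi fun _ : ι => stdLaplace) A ≤
      ENNReal.ofReal (Real.exp ε) * (Measure.pi fun _ : ι => stdLaplace) B := by
  rw [← lintegral_indicator_one hA, ← lintegral_indicator_one hB,
    ← lintegral_pi_stdLaplace_add (measurable_one.indicator hB) v, ← lintegral_const_mul]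
  · refine lintegral_mono fun ω => ?_
    by_cases hω : ω ∈ A
    · rw [Set.indicator_of_mem hω, Set.indicator_of_mem (hAB ω hω), Pi.one_apply, Pi.one_apply,
        one_mul, ← ENNReal.ofReal_prod_of_nonneg (fun i _ => by positivity),
        ← ENNReal.ofReal_mul (by positivity), ← Real.exp_sum, ← Real.exp_add,
        ENNReal.one_le_ofReal, Real.one_le_exp_iff]
      have h := hloss ω hω
      have h2 : ∑ i, (|ω i| - |ω i + v i|) = -∑ i, (|ω i + v i| - |ω i|) := by
        rw [← Finset.sum_neg_distrib]
        exact Finset.sum_congr rfl fun i _ => by ring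
      linarith
    · rw [Set.indicator_of_notMem hω]
      exact zero_le
  · refine Measurable.mul ((measurable_one.indicator hB).comp (measurable_add_const v)) ?_
    refine Finset.measurable_fun_prod _ fun i _ => ?_
    fun_prop

/-- Tail bound for the privacy loss of adaptively chosen translations. -/
theorem measure_loss_gt_le {r : ι → ℕ} (hr : Function.Injective r) {d : ι → (ι → ℝ) → ℝ}
    (hd : ∀ i, Measurable (d i))
    (hdep : ∀ i ω ω', (∀ j, r j < r i → ω j = ω' j) → d i ω = d i ω') {V : ℝ}
    (hV : ∀ ω, ∑ i, d i ω ^ 2 ≤ V) {l : ℝ} (hl : 0 ≤ l) (ε : ℝ) :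
    (Measure.pi fun _ : ι => stdLaplace) {ω | ε < ∑ i, (|ω i + d i ω| - |ω i|)} ≤
      ENNReal.ofReal (Real.exp (l * (l + 1) * V / 2 - l * ε)) := by
  classical
  -- The exponential of the loss, divided by its bound from `lintegral_exp_loss_le`. Since `d i` is
  -- fixed by coordinates of smaller rank, each factor has conditional mean at most 1.
  set ψ : ι → (ι → ℝ) → ENNReal := fun i ω => ENNReal.ofReal
    (Real.exp (l * (|ω i + d i ω| - |ω i|) - l * (l + 1) * d i ω ^ 2 / 2)) with hψdef
  have hψ : ∀ i, Measurable (ψ i) := by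
    intro i
    have := hd i
    fun_prop
  have hone : ∫⁻ ω, ∏ i, ψ i ω ∂(Measure.pi fun _ : ι => stdLaplace) ≤ 1 := by
    refine lintegral_prod_adapted_le_one stdLaplace hr hψ ?_ ?_ Finset.univ
    · intro i ω ω' h
      simp only [hψdef]
      rw [h i le_rfl, hdep i ω ω' fun j hj => h j hj.le]
    · intro i ω
      have h1 : ∀ x, d i (Function.update ω i x) = d i ω := by
        intro x
        refine hdep i _ _ fun j hj => Function.update_of_ne ?_ _ _
        rintro rfl
        exact lt_irrefl _ hj
      have h2 : ∀ x, ψ i (Function.update ω i x) =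
          ENNReal.ofReal (Real.exp (l * (|x + d i ω| - |x|))) *
            ENNReal.ofReal (Real.exp (-(l * (l + 1) * d i ω ^ 2 / 2))) := by
        intro x
        simp only [hψdef, h1, Function.update_self]
        rw [← ENNReal.ofReal_mul (by positivity), ← Real.exp_add, ← sub_eq_add_neg]
      simp_rw [h2]
      rw [lintegral_mul_const _ (by fun_prop)]
      refine (mul_le_mul_left (lintegral_exp_loss_le (d i ω) hl) _).trans ?_
      rw [← ENNReal.ofReal_mul (by positivity), ← Real.exp_add, add_neg_cancel, Real.exp_zero,
        ENNReal.ofReal_one]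
  have hmeas : MeasurableSet {ω : ι → ℝ | ε < ∑ i, (|ω i + d i ω| - |ω i|)} := by
    refine measurableSet_lt measurable_const (Finset.measurable_fun_sum _ fun i _ => ?_)
    have := hd i
    fun_prop
  calc (Measure.pi fun _ : ι => stdLaplace) {ω | ε < ∑ i, (|ω i + d i ω| - |ω i|)}
      = ∫⁻ ω, {ω : ι → ℝ | ε < ∑ i, (|ω i + d i ω| - |ω i|)}.indicator 1 ω
          ∂(Measure.pi fun _ : ι => stdLaplace) := (lintegral_indicator_one hmeas).symm
    _ ≤ ∫⁻ ω, ENNReal.ofReal (Real.exp (l * (l + 1) * V / 2 - l * ε)) * ∏ i, ψ i ω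
          ∂(Measure.pi fun _ : ι => stdLaplace) := by
        refine lintegral_mono fun ω => ?_
        by_cases hω : ω ∈ {ω : ι → ℝ | ε < ∑ i, (|ω i + d i ω| - |ω i|)}
        · rw [Set.indicator_of_mem hω, Pi.one_apply]
          simp only [hψdef]
          rw [← ENNReal.ofReal_prod_of_nonneg (fun i _ => by positivity),
            ← ENNReal.ofReal_mul (by positivity), ← Real.exp_sum, ← Real.exp_add,
            ENNReal.one_le_ofReal, Real.one_le_exp_iff, Finset.sum_sub_distrib, ← Finset.mul_sum,
            ← Finset.sum_div, ← Finset.mul_sum]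
          have h1 := mul_le_mul_of_nonneg_left (le_of_lt hω) hl
          have h2 := mul_le_mul_of_nonneg_left (hV ω) (mul_nonneg hl (by linarith : 0 ≤ l + 1))
          linarith
        · rw [Set.indicator_of_notMem hω]
          exact zero_le
    _ ≤ _ := by
        rw [lintegral_const_mul _ (Finset.measurable_fun_prod _ fun i _ => hψ i)]
        exact mul_le_of_le_one_right zero_le hone

/-- Adaptive composition: a transcript that can be transported from one database to another by a
translation of the noise, where each coordinate of the translation is determined by earlier noise. -/
theorem measure_transcript_le {H : Type*} [MeasurableSpace H] [MeasurableSingletonClass H]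
    [Countable H] {r : ι → ℕ} (hr : Function.Injective r) {f g : (ι → ℝ) → H}
    (hf : Measurable f) (hg : Measurable g) {v : H → ι → ℝ}
    (hfg : ∀ ω, g (ω + v (f ω)) = f ω)
    (hdep : ∀ i ω ω', (∀ j, r j < r i → ω j = ω' j) → v (f ω) i = v (f ω') i) {V : ℝ}
    (hV : ∀ h, ∑ i, v h i ^ 2 ≤ V) {l : ℝ} (hl : 0 ≤ l) (ε : ℝ) (S : Set H) :
    (Measure.pi fun _ : ι => stdLaplace) (f ⁻¹' S) ≤
      ENNReal.ofReal (Real.exp ε) * (Measure.pi fun _ : ι => stdLaplace) (g ⁻¹' S) +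
        ENNReal.ofReal (Real.exp (l * (l + 1) * V / 2 - l * ε)) := by
  set P : Measure (ι → ℝ) := Measure.pi fun _ : ι => stdLaplace
  have hv : ∀ i, Measurable fun ω => v (f ω) i :=
    fun i => (measurable_of_countable fun h : H => v h i).comp hf
  have hbad := measure_loss_gt_le hr hv hdep (fun ω => hV (f ω)) hl ε
  -- Once the transcript is fixed to `h`, the translation `v h` is constant and the non-adaptive
  -- bound applies. Adaptivity matters only for the event of large loss.
  have hA : ∀ h, MeasurableSet ({ω | f ω = h} ∩ {ω | ∑ i, (|ω i + v h i| - |ω i|) ≤ ε}) := by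
    intro h
    refine (hf (measurableSet_singleton h)).inter (measurableSet_le ?_ measurable_const)
    exact Finset.measurable_fun_sum _ fun i _ => by fun_prop
  have hsub : f ⁻¹' S ⊆
      (⋃ h ∈ S, ({ω | f ω = h} ∩ {ω | ∑ i, (|ω i + v h i| - |ω i|) ≤ ε})) ∪
        {ω | ε < ∑ i, (|ω i + v (f ω) i| - |ω i|)} := by
    intro ω hω
    by_cases hle : ∑ i, (|ω i + v (f ω) i| - |ω i|) ≤ ε
    · exact Or.inl (Set.mem_biUnion hω ⟨rfl, hle⟩)
    · exact Or.inr (not_le.1 hle)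
  refine (measure_mono hsub).trans ((measure_union_le _ _).trans (add_le_add ?_ hbad))
  refine (measure_biUnion_le P S.to_countable _).trans ?_
  have hgS : P (g ⁻¹' S) = ∑' h : S, P (g ⁻¹' {(h : H)}) := by
    rw [← measure_biUnion (f := fun h : H => g ⁻¹' {h}) S.to_countable]
    · congr 1
      ext ω
      simp
    · intro h _ h' _ hne
      exact Disjoint.preimage g (by simpa using hne)
    · intro h _
      exact hg (measurableSet_singleton h)
  rw [hgS, ← ENNReal.tsum_mul_left]
  refine ENNReal.tsum_le_tsum fun h => ?_
  refine measure_le_of_loss_le (hA h) (hg (measurableSet_singleton _)) (v h) ?_ ?_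
  · rintro ω ⟨hω, _⟩
    have := hfg ω
    rw [show f ω = h from hω] at this
    exact this
  · rintro ω ⟨_, hω⟩
    exact hω

end Pi

/-! ### Differential privacy -/

section Privacy

variable {n m J N : ℕ} (pick : Rule m) (C : Fin m → ℕ) (E : ℝ) (D : Database n m J)

theorem measurable_underEnrolled (st : State n m) :
    @Measurable _ (Finset (Fin m)) _ ⊤ fun ω : NoiseTape m N => underEnrolled C E st ω := by
  let _ : MeasurableSpace (Finset (Fin m)) := ⊤
  refine measurable_to_countable' fun s => ?_
  have h : (fun ω : NoiseTape m N => underEnrolled C E st ω) ⁻¹' {s} =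
      ⋂ u, {ω | (counterValue st ω u < (C u : ℝ) - E ∧ 0 < st.thr u) ↔ u ∈ s} := by
    ext ω
    simp [underEnrolled, Finset.ext_iff]
  rw [h]
  refine MeasurableSet.iInter fun u => ?_
  have hm : Measurable fun ω : NoiseTape m N => counterValue st ω u := by
    unfold counterValue binaryCounter
    fun_prop
  have h1 : MeasurableSet
      {ω : NoiseTape m N | counterValue st ω u < (C u : ℝ) - E ∧ 0 < st.thr u} :=
    (measurableSet_lt hm measurable_const).inter (MeasurableSet.const _)
  by_cases hu : u ∈ s
  · simpa only [hu, iff_true] using h1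
  · simp only [hu, iff_false]
    exact h1.compl

theorem measurable_hist (k : ℕ) :
    @Measurable _ (List (Fin m)) _ ⊤ fun ω : NoiseTape m N => (runFor pick C E D ω k).hist := by
  classical
  let _ : MeasurableSpace (List (Fin m)) := ⊤
  let _ : MeasurableSpace (Finset (Fin m)) := ⊤
  induction k with
  | zero => exact measurable_const
  | succ k ih =>
    have h1 : Measurable fun p : List (Fin m) × NoiseTape m N =>
        (step pick C E D p.2 (replay D p.1)).hist := by
      refine measurable_from_prod_countable_right fun h => ?_
      have hg : Measurable fun s : Finset (Fin m) => (if s.Nonempty then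
          lower D (replay D h) (pick (replay D h).hist s) else replay D h).hist :=
        measurable_from_top
      have h2 := hg.comp (measurable_underEnrolled (N := N) C E (replay D h))
      convert h2 using 1
      funext ω
      by_cases hs : (underEnrolled C E (replay D h) ω).Nonempty <;> simp [step, hs]
    have h2 := h1.comp (Measurable.prodMk ih measurable_id)
    have e : (fun ω : NoiseTape m N => (runFor pick C E D ω (k + 1)).hist) =
        (fun p : List (Fin m) × NoiseTape m N => (step pick C E D p.2 (replay D p.1)).hist) ∘
          fun ω => ((runFor pick C E D ω k).hist, id ω) := by
      funext ω
      simp only [runFor, Function.comp_apply, id, ← runFor_eq_replay]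
    rw [e]
    exact h2

/-- Unit-scale noise with an explicit factor also covers horizon 1, where the scale is 0. -/
theorem noise_eq_map (ε δ : ℝ) :
    noise n m J ε δ = (Measure.pi fun _ : Fin m × Fin (horizon n m J + 1) => stdLaplace).map
      fun z i => Real.logb 2 (horizon n m J) / counterEps m ε δ * z i := by
  rw [Measure.pi_map_pi (fun _ => by fun_prop)]
  rfl

theorem privateDA_apply (ε δ β : ℝ) (S : Set (Thresholds m)) :
    privateDA pick C ε δ β D S =
      (Measure.pi fun _ : Fin m × Fin (horizon n m J + 1) => stdLaplace)
        {z | finalThresholds pick C (reserve n m J ε δ β) D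
          (fun i => Real.logb 2 (horizon n m J) / counterEps m ε δ * z i) ∈ S} := by
  rw [privateDA, Measure.map_apply (measurable_finalThresholds _ _ _ _)
    MeasurableSet.of_discrete, noise_eq_map, Measure.map_apply (by fun_prop)
    (measurable_finalThresholds _ _ _ _ MeasurableSet.of_discrete)]
  rfl

/-- The privacy guarantee of noise of scale `b`. -/
theorem privacy_of_scale (hn : 0 < n) (hN : n * (m * J) ≤ N) {b : ℝ} (hb : 0 < b)
    {D D' : Database n m J} (hD : Neighbours D D') {l : ℝ} (hl : 0 ≤ l) (ε : ℝ)
    (S : Set (Thresholds m)) :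
    (Measure.pi fun _ : Fin m × Fin (N + 1) => stdLaplace)
        {z | finalThresholds pick C E D (fun i => b * z i) ∈ S} ≤
      ENNReal.ofReal (Real.exp ε) * (Measure.pi fun _ : Fin m × Fin (N + 1) => stdLaplace)
        {z | finalThresholds pick C E D' (fun i => b * z i) ∈ S} +
      ENNReal.ofReal (Real.exp
        (l * (l + 1) * (m * (16 * (Nat.log 2 N + 1)) / b ^ 2) / 2 - l * ε)) := by
  let _ : MeasurableSpace (List (Fin m)) := ⊤
  have _ : MeasurableSingletonClass (List (Fin m)) := ⟨fun _ => trivial⟩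
  set f : Database n m J → NoiseTape m N → List (Fin m) :=
    fun D z => (runFor pick C E D (fun i => b * z i) (m * J)).hist with hf
  -- Coordinates are ranked by time first and by counter second, so that all counters at an earlier
  -- time precede every counter at a later time.
  set r : Fin m × Fin (N + 1) → ℕ := fun i => finProdFinEquiv (i.2, i.1) with hr
  have hmeas : ∀ D, Measurable (f D) := by
    intro D
    have h : Measurable fun z : NoiseTape m N => fun i => b * z i := by fun_prop
    exact (measurable_hist pick C E D (m * J)).comp h
  have hrinj : Function.Injective r := by
    intro i j hij
    have h := finProdFinEquiv.injective (Fin.ext hij)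
    simp only [Prod.mk.injEq] at h
    exact Prod.ext h.2 h.1
  have hrlt : ∀ (u u' : Fin m) (s s' : Fin (N + 1)), (s' : ℕ) < s → r (u', s') < r (u, s) := by
    intro u u' s s' h
    simp only [hr, finProdFinEquiv_apply_val]
    have h1 : m * (s' + 1) ≤ m * (s : ℕ) := Nat.mul_le_mul_left _ h
    have h2 := u'.2
    rw [mul_add, mul_one] at h1
    omega
  have key := measure_transcript_le (H := List (Fin m)) hrinj (hmeas D) (hmeas D')
    (v := fun h i => (blockShift D D' h i.1 i.2 : ℝ) / b)
    (V := m * (16 * (Nat.log 2 N + 1)) / b ^ 2) ?_ ?_ ?_ hl ε {h | (replay D h).thr ∈ S}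
  · have e1 : f D ⁻¹' {h | (replay D h).thr ∈ S} =
        {z | finalThresholds pick C E D (fun i => b * z i) ∈ S} := by
      ext z
      simp only [hf, Set.mem_preimage, Set.mem_ofPred_eq, finalThresholds, ← runFor_eq_replay]
    have e2 : f D' ⁻¹' {h | (replay D h).thr ∈ S} =
        {z | finalThresholds pick C E D' (fun i => b * z i) ∈ S} := by
      ext z
      simp only [hf, Set.mem_preimage, Set.mem_ofPred_eq, finalThresholds, thr_replay_eq D D',
        ← runFor_eq_replay]
    rwa [e1, e2] at key
  · intro z
    have h := hist_runFor_shift pick C E D D' (fun i => b * z i) hN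
    simp only [hf]
    conv_rhs => rw [← h]
    congr 2
    funext i
    rw [Pi.add_apply, mul_add, mul_div_cancel₀ _ hb.ne']
  · rintro ⟨u, s⟩ z z' h
    have h1 := blockShift_runFor_congr pick C E D hn D' (ω := fun i => b * z i)
      (ω' := fun i => b * z' i) (s := s) (fun u' s' hs' => by
        rw [h (u', s') (hrlt u u' s s' hs')]) (m * J) u
    simp only [hf, h1]
  · intro h
    simp_rw [div_pow]
    rw [← Finset.sum_div]
    refine div_le_div_of_nonneg_right ?_ (by positivity)
    exact_mod_cast sum_sq_blockShift_le D hD h N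

/-- With a single pass, the only test happens before any symbol has been sent. -/
theorem finalThresholds_eq_of_one (h1 : m * J = 1) (D' : Database n m J) (ω : NoiseTape m N) :
    finalThresholds pick C E D ω = finalThresholds pick C E D' ω := by
  have key : ∀ D : Database n m J, finalThresholds pick C E D ω =
      (step pick C E D ω (initState n m J)).thr := fun D => by rw [finalThresholds, h1]; rfl
  rw [key, key]
  unfold step
  by_cases h : (underEnrolled C E (initState n m J) ω).Nonempty
  · rw [if_pos h, if_pos h]
    rfl
  · rw [if_neg h, if_neg h]

theorem log_two_le_log_inv {δ : ℝ} (h0 : 0 < δ) (h1 : δ ≤ 1 / 2) :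
    Real.log 2 ≤ Real.log (1 / δ) := by
  refine Real.log_le_log (by norm_num) ?_
  rw [le_div_iff₀ h0]
  linarith

theorem one_le_logb_of_two_le {N : ℕ} (h : 2 ≤ N) : 1 ≤ Real.logb 2 N := by
  rw [Real.le_logb_iff_rpow_le (by norm_num) (by positivity), Real.rpow_one]
  exact_mod_cast h

theorem natLog_succ_le_two_mul_logb {N : ℕ} (h : 2 ≤ N) :
    (Nat.log 2 N : ℝ) + 1 ≤ 2 * Real.logb 2 N := by
  have h1 := one_le_logb_of_two_le h
  have h2 := Real.natLog_le_logb N 2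
  push_cast at h2
  linarith

theorem differentiallyPrivate_privateDA (hn : 0 < n) (hm : 0 < m) (hJ : 0 < J) {ε δ : ℝ} (β : ℝ)
    (hε : 0 < ε) (hε1 : ε ≤ 1) (hδ : 0 < δ) (hδ2 : δ ≤ 1 / 2) :
    DifferentiallyPrivate ε δ (fun D : Database n m J => privateDA pick C ε δ β D) := by
  intro D D' hD S _
  have hℓ : 0.69 ≤ Real.log (1 / δ) :=
    le_trans (by have := Real.log_two_gt_d9; linarith) (log_two_le_log_inv hδ hδ2)
  by_cases hN : horizon n m J = 1
  · have hmJ : m * J = 1 := by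
      have h2 : n * (m * n * J) = 1 := hN
      have h3 := Nat.eq_one_of_mul_eq_one_left h2
      rw [Nat.mul_right_comm] at h3
      exact Nat.eq_one_of_mul_eq_one_right h3
    rw [privateDA_apply, privateDA_apply]
    simp only [finalThresholds_eq_of_one pick C _ D hmJ D']
    refine le_trans (le_mul_of_one_le_left zero_le ?_) (le_add_of_nonneg_right zero_le)
    rw [ENNReal.one_le_ofReal, Real.one_le_exp_iff]
    exact hε.le
  · have hN2 : 2 ≤ horizon n m J := by
      have : 0 < horizon n m J := by unfold horizon; positivity
      omega
    set L := Real.logb 2 (horizon n m J) with hL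
    set ℓ := Real.log (1 / δ) with hℓdef
    have hL1 : 1 ≤ L := one_le_logb_of_two_le hN2
    have hε' : 0 < counterEps m ε δ := by
      unfold counterEps
      have : (0 : ℝ) < m := by exact_mod_cast hm
      have : 0 < √(2 * m * ℓ) := Real.sqrt_pos.2 (by positivity)
      positivity
    have hsq : counterEps m ε δ ^ 2 = ε ^ 2 / (512 * m * ℓ) := by
      unfold counterEps
      rw [div_pow, mul_pow, Real.sq_sqrt (by positivity)]
      congr 1
      ring
    have hb : 0 < L / counterEps m ε δ := by positivity
    have hle : n * (m * J) ≤ horizon n m J := by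
      unfold horizon
      refine Nat.mul_le_mul_left n ?_
      rw [Nat.mul_right_comm]
      exact Nat.le_mul_of_pos_right _ hn
    rw [privateDA_apply, privateDA_apply]
    -- With variance proxy `V ≤ ε² / (16ℓ)`, the choice `l = 2ℓ / ε` turns the tail exponent into at
    -- most `(2ℓ + ε) / 16 - 2ℓ`. This is at most `-ℓ = log δ` because `ε ≤ 1` and `ℓ ≥ 0.69`.
    refine (privacy_of_scale pick C _ hn hle hb hD (l := 2 * ℓ / ε) (by positivity) ε S).trans ?_
    refine add_le_add le_rfl (ENNReal.ofReal_le_ofReal ?_)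
    have hδexp : δ = Real.exp (-ℓ) := by
      rw [hℓdef, one_div, Real.log_inv, neg_neg, Real.exp_log hδ]
    refine le_trans ?_ hδexp.ge
    rw [Real.exp_le_exp]
    have hm' : (0 : ℝ) < m := by exact_mod_cast hm
    have hV : (m : ℝ) * (16 * (Nat.log 2 (horizon n m J) + 1)) / (L / counterEps m ε δ) ^ 2 ≤
        ε ^ 2 / (16 * ℓ) := by
      rw [div_pow, hsq]
      have h1 := natLog_succ_le_two_mul_logb hN2
      rw [← hL] at h1
      rw [div_div_eq_mul_div, div_le_div_iff₀ (by positivity) (by positivity)]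
      have h2 : (m : ℝ) * (16 * (Nat.log 2 (horizon n m J) + 1)) * (ε ^ 2 / (512 * m * ℓ)) *
          (16 * ℓ) = ε ^ 2 * ((Nat.log 2 (horizon n m J) + 1) / 2) := by
        field_simp
        ring
      rw [h2]
      refine mul_le_mul_of_nonneg_left ?_ (by positivity)
      nlinarith
    have h1 : 2 * ℓ / ε * (2 * ℓ / ε + 1) * (ε ^ 2 / (16 * ℓ)) / 2 - 2 * ℓ / ε * ε =
        (2 * ℓ + ε) / 16 - 2 * ℓ := by
      field_simp
    have h2 := mul_le_mul_of_nonneg_left hV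
      (show 0 ≤ 2 * ℓ / ε * (2 * ℓ / ε + 1) by positivity)
    linarith

end Privacy

/-! ### Truthfulness -/

/-- By the layer-cake formula the integral averages the measures of superlevel sets over levels in
`(0, 1]`, so the additive `δ` is paid once. -/
theorem integral_le_of_forall_measure_le {R : Type*} [MeasurableSpace R] {μ ν : Measure R}
    [IsProbabilityMeasure μ] [IsProbabilityMeasure ν] {c δ : ℝ} (hc : 0 ≤ c) (hδ : 0 ≤ δ)
    (h : ∀ S, MeasurableSet S → μ S ≤ ENNReal.ofReal c * ν S + ENNReal.ofReal δ) {w : R → ℝ}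
    (hw : Measurable w) (h0 : ∀ x, 0 ≤ w x) (h1 : ∀ x, w x ≤ 1) :
    ∫ x, w x ∂μ ≤ c * (∫ x, w x ∂ν) + δ := by
  have hint : ∀ ρ : Measure R, IsProbabilityMeasure ρ → Integrable w ρ := fun ρ _ =>
    Integrable.of_mem_Icc 0 1 hw.aemeasurable (Filter.Eventually.of_forall fun x => ⟨h0 x, h1 x⟩)
  have hlayer : ∀ ρ : Measure R, IsProbabilityMeasure ρ →
      ∫ x, w x ∂ρ = ∫ t in Set.Ioc 0 1, ρ.real {a | t ≤ w a} := fun ρ _ =>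
    (hint ρ inferInstance).integral_eq_integral_Ioc_meas_le (Filter.Eventually.of_forall h0)
      (Filter.Eventually.of_forall h1)
  have hanti : ∀ ρ : Measure R, IsProbabilityMeasure ρ →
      IntegrableOn (fun t => ρ.real {a | t ≤ w a}) (Set.Ioc 0 1) := by
    intro ρ _
    have ha : Antitone fun t => ρ.real {a | t ≤ w a} := fun s t hst =>
      measureReal_mono fun a ha => le_trans hst ha
    exact (AntitoneOn.integrableOn_isCompact isCompact_Icc (ha.antitoneOn _)).mono_set Set.Ioc_subset_Icc_self
  rw [hlayer μ inferInstance, hlayer ν inferInstance]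
  calc ∫ t in Set.Ioc (0 : ℝ) 1, μ.real {a | t ≤ w a}
      ≤ ∫ t in Set.Ioc (0 : ℝ) 1, (c * ν.real {a | t ≤ w a} + δ) := by
        refine integral_mono (hanti μ inferInstance)
          (((hanti ν inferInstance).const_mul c).add (integrable_const δ)) fun t => ?_
        have hS := h _ (measurableSet_le measurable_const hw : MeasurableSet {a | t ≤ w a})
        have h2 := ENNReal.toReal_mono (by finiteness) hS
        rw [ENNReal.toReal_add (by finiteness) (by finiteness), ENNReal.toReal_mul,
          ENNReal.toReal_ofReal hc, ENNReal.toReal_ofReal hδ] at h2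
        exact h2
    _ = c * (∫ t in Set.Ioc (0 : ℝ) 1, ν.real {a | t ≤ w a}) + δ := by
        rw [integral_add ((hanti ν inferInstance).const_mul c) (integrable_const δ),
          integral_const_mul]
        simp

/-- Scores and thresholds alone decide which schools are available; the true ordering picks the best
of them. -/
theorem favourite_misreport {m J : ℕ} (s : Student m J) (p' : PrefOrder m) (t : Thresholds m)
    {v : Option (Fin m) → ℝ} (hv : ConsistentUtility s.pref v) :
    v (favourite { pref := p', score := s.score } t) ≤ v (favourite s t) := by
  rcases h' : favourite { pref := p', score := s.score } t with _ | u
  · rcases h : favourite s t with _ | w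
    · exact le_rfl
    · exact hv.2 _ _ trivial
  · have hu : t u ≤ (s.score u : ℕ) := ((favourite_eq_some_iff _ _ _).1 h').1
    rcases eq_or_prefers_favourite s t u hu with h | h
    · rw [h]
    · exact hv.2 _ _ h

theorem studentTruthful_of_differentiallyPrivate {n m J : ℕ} {ε δ : ℝ} (hε : 0 ≤ ε) (hδ : 0 ≤ δ)
    {M : Database n m J → Measure (Thresholds m)} [∀ D, IsProbabilityMeasure (M D)]
    (hM : DifferentiallyPrivate ε δ M) :
    StudentTruthful (ε + δ) fun D => (M D).map (inducedMatching D) := by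
  intro D a v hv p' _
  have hmap : ∀ D' : Database n m J, ∫ μ, v (μ a) ∂((M D').map (inducedMatching D')) =
      ∫ t, v (favourite (D' a) t) ∂(M D') := fun D' =>
    integral_map (measurable_inducedMatching D').aemeasurable
      (Measurable.aestronglyMeasurable (measurable_of_countable _))
  dsimp only
  rw [hmap, hmap]
  have hint : ∀ (ρ : Measure (Thresholds m)) (s : Student m J), IsProbabilityMeasure ρ →
      Integrable (fun t => v (favourite s t)) ρ := fun ρ s _ =>
    Integrable.of_mem_Icc 0 1 (measurable_of_countable _).aemeasurable
      (Filter.Eventually.of_forall fun t => hv.1 _)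
  have h1 : ∫ t, v (favourite (misreport D a p' a) t) ∂(M (misreport D a p')) ≤
      ∫ t, v (favourite (D a) t) ∂(M (misreport D a p')) := by
    refine integral_mono (hint _ _ inferInstance) (hint _ _ inferInstance) fun t => ?_
    simp only [misreport, Function.update_self]
    exact favourite_misreport (D a) p' t hv
  have hnb : Neighbours D (misreport D a p') :=
    ⟨a, fun j hj => by rw [misreport, Function.update_of_ne hj]⟩
  have h2 := integral_le_of_forall_measure_le (Real.exp_pos ε).le hδ (hM _ _ hnb)
    (w := fun t => 1 - v (favourite (D a) t)) (measurable_of_countable _)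
    (fun t => by linarith [(hv.1 (favourite (D a) t)).2])
    (fun t => by linarith [(hv.1 (favourite (D a) t)).1])
  rw [integral_sub (integrable_const _) (hint _ _ inferInstance),
    integral_sub (integrable_const _) (hint _ _ inferInstance)] at h2
  simp only [integral_const, probReal_univ, smul_eq_mul, mul_one] at h2
  have h3 : ∫ t, v (favourite (D a) t) ∂(M D) ≤ 1 := by
    have := integral_mono (hint (M D) (D a) inferInstance) (integrable_const (1 : ℝ))
      fun t => (hv.1 (favourite (D a) t)).2
    simpa using this
  set x := ∫ t, v (favourite (D a) t) ∂(M D)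
  set y := ∫ t, v (favourite (D a) t) ∂(M (misreport D a p'))
  have hx0 : 0 ≤ x := integral_nonneg fun t => (hv.1 _).1
  -- Dividing by `exp ε` makes the multiplicative loss `1 - exp (-ε) ≤ ε`, so the total is `ε + δ`
  -- instead of `exp ε - 1 + δ`.
  have h4 : Real.exp (-ε) * (1 - x - δ) ≤ 1 - y := by
    have h5 := mul_le_mul_of_nonneg_left h2 (Real.exp_pos (-ε)).le
    have h6 : Real.exp (-ε) * Real.exp ε = 1 := by rw [← Real.exp_add]; simp
    have h7 : Real.exp (-ε) * (Real.exp ε * (1 - y) + δ) = 1 - y + Real.exp (-ε) * δ := by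
      rw [mul_add, ← mul_assoc, h6, one_mul]
    linarith
  have h8 : 1 - ε ≤ Real.exp (-ε) := by linarith [Real.add_one_le_exp (-ε)]
  have h9 : Real.exp (-ε) ≤ 1 := Real.exp_le_one_iff.2 (by linarith)
  nlinarith [mul_le_mul_of_nonneg_right h8 (sub_nonneg.2 h3), mul_le_mul_of_nonneg_right h9 hδ,
    mul_nonneg hε hx0]

/-! ### Accuracy of the counters -/

section Noise

/-- Chernoff's bound at exponent 1/2, where each independent factor has mean exactly 2. -/
theorem measure_sum_abs_gt_le {ι : Type*} [Fintype ι] (s : Finset ι) (x : ℝ) :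
    (Measure.pi fun _ : ι => stdLaplace) {z | x < ∑ i ∈ s, |z i|} ≤
      ENNReal.ofReal (2 ^ s.card * Real.exp (-(x / 2))) := by
  have hmeas : MeasurableSet {z : ι → ℝ | x < ∑ i ∈ s, |z i|} :=
    measurableSet_lt measurable_const (Finset.measurable_fun_sum _ fun i _ => by fun_prop)
  have hexp := lintegral_pi_prod stdLaplace s
    (f := fun _ x => ENNReal.ofReal (Real.exp (|x| / 2))) fun _ => by fun_prop
  simp only [lintegral_exp_half_abs_stdLaplace, Finset.prod_const] at hexp
  calc (Measure.pi fun _ : ι => stdLaplace) {z | x < ∑ i ∈ s, |z i|}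
      = ∫⁻ z, {z : ι → ℝ | x < ∑ i ∈ s, |z i|}.indicator 1 z
          ∂(Measure.pi fun _ : ι => stdLaplace) := (lintegral_indicator_one hmeas).symm
    _ ≤ ∫⁻ z, ENNReal.ofReal (Real.exp (-(x / 2))) *
          ∏ i ∈ s, ENNReal.ofReal (Real.exp (|z i| / 2))
          ∂(Measure.pi fun _ : ι => stdLaplace) := by
        refine lintegral_mono fun z => ?_
        by_cases hz : z ∈ {z : ι → ℝ | x < ∑ i ∈ s, |z i|}
        · rw [Set.indicator_of_mem hz, Pi.one_apply,
            ← ENNReal.ofReal_prod_of_nonneg (fun i _ => by positivity),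
            ← ENNReal.ofReal_mul (by positivity), ← Real.exp_sum, ← Real.exp_add,
            ENNReal.one_le_ofReal, Real.one_le_exp_iff, ← Finset.sum_div]
          have hz' : x < ∑ i ∈ s, |z i| := hz
          linarith
        · rw [Set.indicator_of_notMem hz]
          exact zero_le
    _ = _ := by
        rw [lintegral_const_mul _ (Finset.measurable_fun_prod _ fun i _ => by fun_prop), hexp,
          mul_comm, ENNReal.ofReal_mul (by positivity), ENNReal.ofReal_pow (by norm_num),
          ENNReal.ofReal_ofNat]

variable {m N : ℕ}

/-- Distinct bits read distinct tape entries, and the factor 2 per entry is harmless because `t` has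
at most `Nat.log 2 t + 1` bits. -/
theorem measure_readNoise_gt_le {b : ℝ} (hb : 0 ≤ b) (u : Fin m) {t : ℕ} (ht : t ≤ N)
    (ht0 : 0 < t) (x : ℝ) :
    (Measure.pi fun _ : Fin m × Fin (N + 1) => stdLaplace)
        {z | b * x < |readNoise (fun i => b * z i) u t|} ≤
      ENNReal.ofReal (2 * t * Real.exp (-(x / 2))) := by
  classical
  set S : Finset (Fin m × Fin (N + 1)) :=
    (bits t).image fun j => (u, Fin.ofNat (N + 1) (stamp t j)) with hS
  have hinj : Set.InjOn (fun j => (u, Fin.ofNat (N + 1) (stamp t j))) (bits t : Set ℕ) := by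
    intro i hi j hj hij
    have h1 := congrArg Fin.val (Prod.mk.inj hij).2
    have hi' := (stamp_le t i).trans ht
    have hj' := (stamp_le t j).trans ht
    simp only [Fin.val_ofNat] at h1
    rw [Nat.mod_eq_of_lt (by omega), Nat.mod_eq_of_lt (by omega)] at h1
    exact stamp_injOn t hi hj h1
  have habs : ∀ z : NoiseTape m N, |readNoise (fun i => b * z i) u t| ≤ b * ∑ i ∈ S, |z i| := by
    intro z
    rw [readNoise, ← Finset.mul_sum, abs_mul, abs_of_nonneg hb, hS, Finset.sum_image hinj]
    exact mul_le_mul_of_nonneg_left (Finset.abs_sum_le_sum_abs _ _) hb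
  have hcard : (2 : ℝ) ^ S.card ≤ 2 * t := by
    have h1 : S.card ≤ Nat.log 2 t + 1 := by
      refine Finset.card_image_le.trans ((card_bits_le t).trans ?_)
      rw [Nat.size_le]
      exact Nat.lt_pow_succ_log_self (by norm_num) t
    calc (2 : ℝ) ^ S.card ≤ 2 ^ (Nat.log 2 t + 1) := pow_le_pow_right₀ (by norm_num) h1
      _ = 2 * (2 ^ Nat.log 2 t : ℕ) := by push_cast; ring
      _ ≤ 2 * t := by
        have := Nat.pow_log_le_self 2 ht0.ne'
        gcongr
  refine (measure_mono fun z hz => ?_).trans ((measure_sum_abs_gt_le S x).trans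
    (ENNReal.ofReal_le_ofReal (mul_le_mul_of_nonneg_right hcard (by positivity))))
  have hz' : b * x < |readNoise (fun i => b * z i) u t| := hz
  have h1 := hz'.trans_le (habs z)
  exact lt_of_mul_lt_mul_left h1 hb

/-- With probability at least `1 - β`, all noise at the times of the tests is small. -/
theorem measure_readNoise_le {n J : ℕ} (hn : 0 < n) (hm : 0 < m) (hJ : 0 < J)
    (hN : n * (m * J) ≤ N) {b : ℝ} (hb : 0 ≤ b) {β : ℝ} (hβ : 0 < β) (hβ1 : β < 1) :
    ENNReal.ofReal (1 - β) ≤ (Measure.pi fun _ : Fin m × Fin (N + 1) => stdLaplace)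
      {z | ∀ u, ∀ k ≤ m * J, |readNoise (fun i => b * z i) u (n * k)| ≤
        b * (2 * Real.log (2 * (n * m ^ 3 * J ^ 2) / β))} := by
  set P : Measure (NoiseTape m N) := Measure.pi fun _ : Fin m × Fin (N + 1) => stdLaplace
  have hn' : (1 : ℝ) ≤ n := by exact_mod_cast hn
  have hm' : (1 : ℝ) ≤ m := by exact_mod_cast hm
  have hJ' : (1 : ℝ) ≤ J := by exact_mod_cast hJ
  set y : ℝ := 2 * (n * m ^ 3 * J ^ 2) / β with hy
  set x : ℝ := 2 * Real.log y with hx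
  have hy1 : 1 ≤ y := by
    rw [hy, le_div_iff₀ hβ]
    have h1 : (1 : ℝ) ≤ n * m ^ 3 * J ^ 2 := by
      have := one_le_mul_of_one_le_of_one_le hn' (one_le_pow₀ hm' (n := 3))
      exact one_le_mul_of_one_le_of_one_le this (one_le_pow₀ hJ' (n := 2))
    linarith
  have hx0 : 0 ≤ x := mul_nonneg (by norm_num) (Real.log_nonneg hy1)
  set good : Set (NoiseTape m N) :=
    {z | ∀ u, ∀ k ≤ m * J, |readNoise (fun i => b * z i) u (n * k)| ≤ b * x} with hgood
  -- The read at `k = 0` uses no block and carries no noise. The union bound over the `m` counters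
  -- and the `m * J` other read times, each failing with probability at most `2nmJ / y`, gives
  -- exactly `β`.
  have hsub : goodᶜ ⊆ ⋃ p ∈ (Finset.univ : Finset (Fin m)) ×ˢ Finset.Icc 1 (m * J),
      {z | b * x < |readNoise (fun i => b * z i) p.1 (n * p.2)|} := by
    intro z hz
    simp only [hgood, Set.mem_compl_iff, Set.mem_ofPred_eq] at hz
    push Not at hz
    obtain ⟨u, k, hk, hlt⟩ := hz
    have hk0 : 1 ≤ k := by
      by_contra h0
      have : k = 0 := by omega
      subst this
      have h0 : readNoise (fun i => b * z i) u (n * 0) = 0 := by simp [readNoise, bits]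
      rw [h0, abs_zero] at hlt
      exact absurd hlt (not_lt.2 (by positivity))
    exact Set.mem_biUnion (x := (u, k))
      (Finset.mem_coe.2 (Finset.mem_product.2 ⟨Finset.mem_univ _, Finset.mem_Icc.2 ⟨hk0, hk⟩⟩)) hlt
  have hexp : Real.exp (-(x / 2)) = y⁻¹ := by
    rw [hx, mul_div_cancel_left₀ _ two_ne_zero, Real.exp_neg, Real.exp_log (by linarith)]
  have hbad : P goodᶜ ≤ ENNReal.ofReal β := by
    refine (measure_mono hsub).trans ((measure_biUnion_finset_le _ _).trans ?_)
    have hterm : ∀ p ∈ (Finset.univ : Finset (Fin m)) ×ˢ Finset.Icc 1 (m * J),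
        P {z | b * x < |readNoise (fun i => b * z i) p.1 (n * p.2)|} ≤
          ENNReal.ofReal (2 * (n * (m * J)) * y⁻¹) := by
      rintro ⟨u, k⟩ hp
      have hk := Finset.mem_Icc.1 (Finset.mem_product.1 hp).2
      have hnk : n * k ≤ n * (m * J) := Nat.mul_le_mul_left _ hk.2
      refine (measure_readNoise_gt_le hb u (hnk.trans hN) (Nat.mul_pos hn hk.1) x).trans
        (ENNReal.ofReal_le_ofReal ?_)
      rw [hexp]
      have h2 : ((n * k : ℕ) : ℝ) ≤ n * (m * J) := by exact_mod_cast hnk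
      gcongr
    refine (Finset.sum_le_sum hterm).trans ?_
    rw [Finset.sum_const, Finset.card_product, Finset.card_univ, Fintype.card_fin, Nat.card_Icc,
      Nat.add_sub_cancel, nsmul_eq_mul, ← ENNReal.ofReal_natCast, ← ENNReal.ofReal_mul
      (by positivity)]
    refine ENNReal.ofReal_le_ofReal (le_of_eq ?_)
    rw [hy]
    push_cast
    field_simp
  have huniv : (1 : ENNReal) ≤ P good + P goodᶜ := by
    rw [← measure_univ (μ := P), ← Set.union_compl_self good]
    exact measure_union_le _ _
  rw [ENNReal.ofReal_sub _ hβ.le, ENNReal.ofReal_one, tsub_le_iff_right]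
  exact huniv.trans (add_le_add le_rfl hbad)

end Noise

/-! ### The size of the reserve -/

section Reserve

variable {n m J : ℕ} {ε δ β : ℝ}

theorem scale_eq : Real.logb 2 (horizon n m J) / counterEps m ε δ =
    16 * √2 * (√(m * Real.log (1 / δ)) / ε) * Real.logb 2 (horizon n m J) := by
  rw [counterEps, mul_assoc 2, Real.sqrt_mul (by norm_num), div_div_eq_mul_div]
  ring

/-- Bounds on the noise in terms of the reserve. -/
theorem scale_mul_le_reserve (hn : 0 < n) (hm : 0 < m) (hJ : 0 < J) (hε : 0 < ε)
    (hβ : 0 < β) (hβ1 : β < 1) :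
    Real.logb 2 (horizon n m J) / counterEps m ε δ *
        (2 * Real.log (2 * (n * m ^ 3 * J ^ 2) / β)) ≤ 2 * reserve n m J ε δ β ∧
      (2 ≤ n → Real.logb 2 (horizon n m J) / counterEps m ε δ *
        (2 * Real.log (2 * (n * m ^ 3 * J ^ 2) / β)) ≤ reserve n m J ε δ β) := by
  have hn' : (1 : ℝ) ≤ n := by exact_mod_cast hn
  have hm' : (1 : ℝ) ≤ m := by exact_mod_cast hm
  have hJ' : (1 : ℝ) ≤ J := by exact_mod_cast hJ
  have hN1 : 1 ≤ horizon n m J := by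
    have : 0 < horizon n m J := by unfold horizon; positivity
    omega
  have hNr : ((horizon n m J : ℕ) : ℝ) = n ^ 2 * m * J := by
    rw [horizon]; push_cast; ring
  rw [scale_eq, reserve]
  set L := Real.logb 2 (horizon n m J) with hL
  set G := Real.log (2 * m / β) with hG
  set A := √(m * Real.log (1 / δ)) / ε with hA
  have hA0 : 0 ≤ A := by positivity
  have hlog2 : 0 < Real.log 2 := Real.log_pos (by norm_num)
  have hG2 : Real.log 2 ≤ G := by
    refine Real.log_le_log (by norm_num) ?_
    rw [le_div_iff₀ hβ]
    nlinarith
  have hG0 : 0 ≤ G := hlog2.le.trans hG2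
  have hsq : √2 ≤ 1.415 := Real.sqrt_le_iff.2 ⟨by norm_num, by norm_num⟩
  have hlogN : Real.log (n ^ 2 * m * J) = L * Real.log 2 := by
    rw [hL, Real.logb, hNr, div_mul_cancel₀ _ hlog2.ne']
  -- The argument is `(2m / β) · (n²mJ)² / n³`, which ties the noise bound to the two logarithms in
  -- the reserve.
  have hW : Real.log (2 * (n * m ^ 3 * J ^ 2) / β) =
      G + 2 * (L * Real.log 2) - 3 * Real.log n := by
    have hn0 : (n : ℝ) ≠ 0 := by positivity
    have hm0 : (m : ℝ) ≠ 0 := by positivity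
    have hJ0 : (J : ℝ) ≠ 0 := by positivity
    rw [← hlogN, hG, Real.log_div (by positivity) hβ.ne', Real.log_div (by positivity) hβ.ne',
      Real.log_mul (by norm_num) (by positivity), Real.log_mul (by positivity) (by positivity),
      Real.log_mul hn0 (by positivity), Real.log_mul (by norm_num) hm0,
      Real.log_mul (by positivity) hJ0, Real.log_mul (by positivity) hm0, Real.log_pow,
      Real.log_pow, Real.log_pow]
    push_cast
    ring
  have hlogn : 0 ≤ Real.log n := Real.log_nonneg hn'
  -- Here `45.28 = 2 · 16 · 1.415`, and `L² ≤ √L ^ 5` needs `L ≥ 1`. At horizon 1 both sides vanish.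
  -- The values `c = 3` and `c = 2` used below fit under `2 · 128` and `128`.
  have hmain : ∀ c : ℝ, 0 ≤ c → (1 ≤ L → Real.log (2 * (n * m ^ 3 * J ^ 2) / β) ≤ c * (G * L)) →
      16 * √2 * A * L * (2 * Real.log (2 * (n * m ^ 3 * J ^ 2) / β)) ≤
        c * 45.28 * (A * G * √L ^ 5) := by
    intro c hc h
    by_cases hN : horizon n m J = 1
    · have h0 : L = 0 := by rw [hL, hN]; simp
      rw [h0]
      simp
    · have hL1 : 1 ≤ L := one_le_logb_of_two_le (by omega)
      have h5 : L ^ 2 ≤ √L ^ 5 := by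
        have h1 : √L ^ 5 = (√L ^ 2) ^ 2 * √L := by ring
        rw [h1, Real.sq_sqrt (by linarith)]
        exact le_mul_of_one_le_right (by positivity) (Real.one_le_sqrt.2 hL1)
      calc 16 * √2 * A * L * (2 * Real.log (2 * (n * m ^ 3 * J ^ 2) / β))
          ≤ 16 * 1.415 * A * L * (2 * (c * (G * L))) := by
            have := h hL1
            have hpos : 0 ≤ Real.log (2 * (n * m ^ 3 * J ^ 2) / β) := by
              rw [hW]
              have h6 : 2 * Real.log n ≤ L * Real.log 2 := by
                rw [← hlogN, ← Nat.cast_ofNat (R := ℝ), ← Real.log_pow]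
                refine Real.log_le_log (by positivity) ?_
                rw [mul_assoc]
                exact le_mul_of_one_le_right (by positivity)
                  (one_le_mul_of_one_le_of_one_le hm' hJ')
              linarith
            gcongr
        _ = c * 45.28 * (A * G * L ^ 2) := by ring
        _ ≤ _ := by gcongr
  have hR0 : 0 ≤ A * G * √L ^ 5 := by positivity
  constructor
  · have h := hmain 3 (by norm_num) fun hL1 => by
      rw [hW]
      have h1 := mul_le_mul_of_nonneg_left hG2 (by linarith : 0 ≤ L)
      nlinarith
    linarith [show 128 * √(m * Real.log (1 / δ)) / ε * G * √L ^ 5 =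
      128 * (A * G * √L ^ 5) by rw [hA]; ring]
  · intro hn2
    -- For `n ≥ 2` the term `-3 log n` absorbs the excess and lowers the constant from 3 to 2.
    have hlogn2 : Real.log 2 ≤ Real.log n :=
      Real.log_le_log (by norm_num) (by exact_mod_cast hn2)
    have h := hmain 2 (by norm_num) fun hL1 => by
      rw [hW]
      nlinarith [mul_nonneg (sub_nonneg.2 hG2) (by linarith : 0 ≤ 2 * L - 1)]
    linarith [show 128 * √(m * Real.log (1 / δ)) / ε * G * √L ^ 5 =
      128 * (A * G * √L ^ 5) by rw [hA]; ring]

theorem three_mul_reserve_le (hn : 0 < n) (hm : 0 < m) (hJ : 0 < J) (hε : 0 < ε)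
    (hδ : 0 < δ) (hδ2 : δ ≤ 1 / 2) (hβ : 0 < β) (hβ1 : β < 1) :
    3 * reserve n m J ε δ β ≤
      10000 * (√m / ε) * Real.log (n * m * J / (δ * β)) ^ 4 := by
  have hn' : (1 : ℝ) ≤ n := by exact_mod_cast hn
  have hm' : (1 : ℝ) ≤ m := by exact_mod_cast hm
  have hJ' : (1 : ℝ) ≤ J := by exact_mod_cast hJ
  have hNr : ((horizon n m J : ℕ) : ℝ) = n ^ 2 * m * J := by
    rw [horizon]; push_cast; ring
  have hnm : (1 : ℝ) ≤ n * m := one_le_mul_of_one_le_of_one_le hn' hm'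
  have hnmJ : (1 : ℝ) ≤ n * m * J := one_le_mul_of_one_le_of_one_le hnm hJ'
  have hmnmJ : (m : ℝ) ≤ n * m * J := by
    calc (m : ℝ) ≤ n * m := le_mul_of_one_le_left (by linarith) hn'
      _ ≤ n * m * J := le_mul_of_one_le_right (by positivity) hJ'
  set Λ := Real.log (n * m * J / (δ * β)) with hΛ
  have hδβ : 0 < δ * β := by positivity
  have h1 : Real.log (1 / δ) ≤ Λ := by
    refine Real.log_le_log (by positivity) ?_
    rw [div_le_div_iff₀ hδ hδβ]
    nlinarith
  have h2 : Real.log (2 * m / β) ≤ Λ := by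
    refine Real.log_le_log (by positivity) ?_
    rw [div_le_div_iff₀ hβ hδβ]
    calc 2 * m * (δ * β) = m * β * (2 * δ) := by ring
      _ ≤ n * m * J * β * 1 := by gcongr; linarith
      _ = _ := by ring
  have hΛ0 : 0 ≤ Λ := (Real.log_nonneg (by rw [le_div_iff₀ hδ]; linarith)).trans h1
  -- Since `n²mJ ≤ (nmJ)²`, the natural logarithm is at most `2Λ`, and `2 / log 2 < 3`.
  have h3 : Real.logb 2 (horizon n m J) ≤ 3 * Λ := by
    have h4 : Real.log (horizon n m J) ≤ 2 * Λ := by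
      rw [hΛ, ← Nat.cast_ofNat (R := ℝ), ← Real.log_pow, hNr]
      refine Real.log_le_log (by positivity) ?_
      have h5 : (n : ℝ) * m * J ≤ n * m * J / (δ * β) := by
        rw [le_div_iff₀ hδβ]
        exact mul_le_of_le_one_right (by positivity) (by nlinarith)
      calc (n : ℝ) ^ 2 * m * J ≤ n ^ 2 * m * J * (m * J) :=
            le_mul_of_one_le_right (by positivity) (one_le_mul_of_one_le_of_one_le hm' hJ')
        _ = (n * m * J) ^ 2 := by ring
        _ ≤ _ := by gcongr
    have h6 := Real.log_two_gt_d9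
    rw [Real.logb, div_le_iff₀ (by linarith)]
    nlinarith
  have hs3 : √3 ≤ 1.733 := Real.sqrt_le_iff.2 ⟨by norm_num, by norm_num⟩
  have h0 : 0 ≤ Real.log (2 * m / β) :=
    Real.log_nonneg (by rw [le_div_iff₀ hβ]; linarith)
  unfold reserve
  calc 3 * (128 * √(m * Real.log (1 / δ)) / ε * Real.log (2 * m / β) *
        √(Real.logb 2 (horizon n m J)) ^ 5)
      ≤ 3 * (128 * √(m * Λ) / ε * Λ * √(3 * Λ) ^ 5) := by gcongr
    -- The powers of `Λ` are 1/2, 1 and 5/2, which add up to the exponent 4 of the theorem.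
    _ = 384 * √3 ^ 5 * (√m / ε) * (Λ * (√Λ ^ 2) ^ 3) := by
        rw [Real.sqrt_mul (by positivity), Real.sqrt_mul (by norm_num)]
        ring
    _ = 384 * √3 ^ 5 * (√m / ε) * Λ ^ 4 := by
        rw [Real.sq_sqrt hΛ0]
        ring
    _ ≤ 10000 * (√m / ε) * Λ ^ 4 := by
        gcongr
        calc 384 * √3 ^ 5 ≤ 384 * 1.733 ^ 5 := by gcongr
          _ ≤ 10000 := by norm_num

/-- The quotient is at least 1 and the logarithm at least `log 2 > 1/2`. Capacity 2 is what the
initial state and the case of a single student need. -/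
theorem two_le_capacity {α c : ℝ} (hn : 0 < n) (hm : 0 < m) (hJ : 0 < J) (hε : 0 < ε)
    (hε1 : ε ≤ 1) (hδ : 0 < δ) (hδ2 : δ ≤ 1 / 2) (hβ : 0 < β) (hβ1 : β < 1) (hα : 0 < α)
    (hα1 : α ≤ 1)
    (hc : 10000 * (√m / (ε * α)) * Real.log (n * m * J / (δ * β)) ^ 4 ≤ c) : 2 ≤ c := by
  have hn' : (1 : ℝ) ≤ n := by exact_mod_cast hn
  have hm' : (1 : ℝ) ≤ m := by exact_mod_cast hm
  have hJ' : (1 : ℝ) ≤ J := by exact_mod_cast hJ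
  have hnmJ : (1 : ℝ) ≤ n * m * J :=
    one_le_mul_of_one_le_of_one_le (one_le_mul_of_one_le_of_one_le hn' hm') hJ'
  refine le_trans ?_ hc
  have h1 : (1 : ℝ) ≤ √m / (ε * α) := by
    rw [le_div_iff₀ (by positivity), one_mul]
    exact le_trans (mul_le_one₀ hε1 hα.le hα1) (Real.one_le_sqrt.2 hm')
  have h2 : (1 / 2 : ℝ) ≤ Real.log (n * m * J / (δ * β)) := by
    have h3 := Real.log_two_gt_d9
    refine le_trans (by linarith) (Real.log_le_log (by norm_num) (?_ : (2 : ℝ) ≤ _))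
    rw [le_div_iff₀ (by positivity)]
    nlinarith
  calc (2 : ℝ) ≤ 10000 * 1 * (1 / 2) ^ 4 := by norm_num
    _ ≤ _ := by gcongr

end Reserve

/-- Private deferred acceptance is accurate for large capacities. -/
theorem ofReal_le_privateDA {n m J : ℕ} (hn : 0 < n) (hm : 0 < m) (hJ : 0 < J) {pick : Rule m}
    (hpick : pick.Valid) {C : Fin m → ℕ} {ε δ β α : ℝ} (hε : 0 < ε) (hε1 : ε ≤ 1) (hδ : 0 < δ)
    (hδ2 : δ ≤ 1 / 2) (hβ : 0 < β) (hβ1 : β < 1) (hα : 0 < α) (hα1 : α ≤ 1)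
    (hC : ∀ u, 10000 * (√m / (ε * α)) * Real.log (n * m * J / (δ * β)) ^ 4 ≤ (C u : ℝ))
    {D : Database n m J} (hD : UniqueScores D) :
    ENNReal.ofReal (1 - β) ≤ privateDA pick C ε δ β D
      {t | ApproxStable C α D (inducedMatching D t) ∧
        SchoolDominant C D (inducedMatching D t)} := by
  have hC2 : ∀ u, 2 ≤ C u := fun u => by
    exact_mod_cast two_le_capacity hn hm hJ hε hε1 hδ hδ2 hβ hβ1 hα hα1 (hC u)
  obtain ⟨hX2, hX1⟩ := scale_mul_le_reserve (δ := δ) hn hm hJ hε hβ hβ1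
  have hN : n * (m * J) ≤ horizon n m J := by
    unfold horizon
    refine Nat.mul_le_mul_left n ?_
    rw [Nat.mul_right_comm]
    exact Nat.le_mul_of_pos_right _ hn
  have hN1 : 1 ≤ horizon n m J :=
    (Nat.mul_pos hn (Nat.mul_pos hm hJ)).trans_le hN
  have hb : 0 ≤ Real.logb 2 (horizon n m J) / counterEps m ε δ := by
    refine div_nonneg (Real.logb_nonneg (by norm_num) (by exact_mod_cast hN1)) ?_
    unfold counterEps
    positivity
  rw [privateDA_apply]
  refine (measure_readNoise_le hn hm hJ hN hb hβ hβ1).trans (measure_mono fun z hz => ?_)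
  refine approxStable_and_schoolDominant hpick hD hC2 ?_ (fun u => ?_) hz
  -- For `n = 1` the noise bound is only known to be at most twice the reserve, but one student
  -- cannot overfill a school with two seats.
  · by_cases hn2 : 2 ≤ n
    · exact Or.inl (hX1 hn2)
    · exact Or.inr fun u => by have := hC2 u; omega
  -- For every `n` the noise is at most twice the reserve, so reserve plus noise costs at most three
  -- reserves.
  · have h1 := three_mul_reserve_le hn hm hJ hε hδ hδ2 hβ hβ1
    have h2 := mul_le_mul_of_nonneg_left (hC u) hα.le
    have h3 : α * (10000 * (√m / (ε * α)) * Real.log (n * m * J / (δ * β)) ^ 4) =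
        10000 * (√m / ε) * Real.log (n * m * J / (δ * β)) ^ 4 := by
      field_simp
    linarith

end PrivateDA

open PrivateDA

theorem mainTheorem1 :
    (∀ (n m J : ℕ), 0 < n → 0 < m → 0 < J →
      ∀ (pick : Rule m), pick.Valid → ∀ (C : Fin m → ℕ) (ε δ β : ℝ),
        0 < ε → ε ≤ 1 → 0 < δ → δ ≤ 1 / 2 → 0 < β → β < 1 →
          DifferentiallyPrivate ε δ
              (fun D : Database n m J => privateDA pick C ε δ β D) ∧
            StudentTruthful (ε + δ)
              (fun D : Database n m J =>
                (privateDA pick C ε δ β D).map (inducedMatching D))) ∧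
    ∃ (K : ℝ) (p : ℕ), 0 < K ∧
      ∀ (n m J : ℕ), 0 < n → 0 < m → 0 < J →
        ∀ (pick : Rule m), pick.Valid → ∀ (C : Fin m → ℕ) (ε δ β α : ℝ),
          0 < ε → ε ≤ 1 → 0 < δ → δ ≤ 1 / 2 → 0 < β → β < 1 → 0 < α → α ≤ 1 →
            (∀ u, K * (√m / (ε * α)) * Real.log (n * m * J / (δ * β)) ^ p ≤ (C u : ℝ)) →
              ∀ D : Database n m J, UniqueScores D →
                ENNReal.ofReal (1 - β) ≤
                  privateDA pick C ε δ β D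
                    {t | ApproxStable C α D (inducedMatching D t) ∧
                      SchoolDominant C D (inducedMatching D t)} := by
  refine ⟨fun n m J hn hm hJ pick _ C ε δ β hε hε1 hδ hδ2 _ _ => ?_, 10000, 4, by norm_num,
    fun n m J hn hm hJ pick hpick C ε δ β α hε hε1 hδ hδ2 hβ hβ1 hα hα1 hC D hD =>
      ofReal_le_privateDA hn hm hJ hpick hε hε1 hδ hδ2 hβ hβ1 hα hα1 hC hD⟩
  have hDP := differentiallyPrivate_privateDA pick C hn hm hJ β hε hε1 hδ hδ2
  exact ⟨hDP, studentTruthful_of_differentiallyPrivate hε.le hδ.le hDP⟩
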